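/- **Setting.** Let $\mu_1,\mu_2$ be $\sigma$-finite reference measures on $\mathbb R$ (Lebesgue measure for continuous outcomes). Independent, identically distributed dyads $i=0,1,2,\dots$ have a binary treatment $A_i\in\{0,1\}$ and, for each value $(a',a'')\in\{0,1\}^2$ of the split treatment, potential outcomes $(Y^1_i(a',a''),Y^2_i(a',a''))\in\mathbb R^2$ with a positive joint density $p_{a',a''}(y^1,y^2)$ with respect to $\mu_1\otimes\mu_2$ whose conditional densities are well defined at every point. Assume the chain graph restrictions: the conditional density of $Y^1(a',a'')$ given $Y^2(a',a'')$ does not depend on $a''$, and that of $Y^2(a',a'')$ given $Y^1(a',a'')$ does not depend on $a'$. There are no covariates; the treatment is randomised: $(Y^1(a,a),Y^2(a,a))\perp A$ and $P(A=a)>0$ for $a=0,1$. One observes $A_i$ and $Y^j_i=Y^j_i(A_i,A_i)$, so $p_{a,a}$ is the density of $(Y^1,Y^2)$ given $A=a$. Put $$f(y^1\mid a,Y^2=0)=\frac{p_{a,a}(y^1,0)}{\int p_{a,a}(y,0)\,d\mu_1(y)},\quad f(y^2\mid a,Y^1=0)=\frac{p_{a,a}(0,y^2)}{\int p_{a,a}(0,y)\,d\mu_2(y)},\quad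 \gamma(y^1,y^2)=\frac{p_{a,a}(y^1,y^2)\,p_{a,a}(0,0)}{p_{a,a}(y^1,0)\,p_{a,a}(0,y^2)},$$ where the odds ratio $\gamma$ does not depend on $a$ under the restrictions (take $a=0$ in the definition). For fixed $a',a''$ and a measurable $h$ let $$\beta_h=\beta_h(a',a'')=\iint h(y^1,y^2)\,f(y^1\mid a',Y^2=0)\,\gamma(y^1,y^2)\,f(y^2\mid a'',Y^1=0)\,d\mu_1\,d\mu_2,\qquad \psi(a',a'')=\frac{\beta_{y^1}(a',a'')}{\beta_1(a',a'')} .$$ **Models and estimators.** Let $f_1(y^1\mid a;\omega_1)$, $f_2(y^2\mid a;\omega_2)$, $\gamma(y^1,y^2;\nu)$ be parametric models for $f(y^1\mid a,Y^2=0)$, $f(y^2\mid a,Y^1=0)$, $\gamma$, with parameters in compact metric spaces $\Theta_1,\Theta_2,N$ (e.g. compact sets of vectors). All are positive and measurable in the outcomes; $f_1,f_2$ are probability densities with finite means $e_1(a;\omega_1),e_2(a;\omega_2)$; and $$f_1(y^1\mid a,y^2;\omega_1,\nu)=\frac{f_1(y^1\mid a;\omega_1)\gamma(y^1,y^2;\nu)}{\int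 f_1(y\mid a;\omega_1)\gamma(y,y^2;\nu)\,d\mu_1(y)},\qquad f_2(y^2\mid a,y^1;\omega_2,\nu)=\frac{f_2(y^2\mid a;\omega_2)\gamma(y^1,y^2;\nu)}{\int f_2(y\mid a;\omega_2)\gamma(y^1,y;\nu)\,d\mu_2(y)}$$ have finite denominators. For each $\nu$ let $\tilde\omega_1(\nu)$ maximise $\sum_{i<n}\log f_1(y^1_i\mid a_i,y^2_i;\omega_1,\nu)$ over $\omega_1$, let $\tilde\omega_2(\nu)$ maximise $\sum_{i<n}\log f_2(y^2_i\mid a_i,y^1_i;\omega_2,\nu)$ over $\omega_2$, and let $\hat\nu=\hat\nu_{dr}\in N$ solve $\sum_{i<n}S(a_i,y_i^1,y_i^2;\tilde\omega_1(\hat\nu),\tilde\omega_2(\hat\nu),\hat\nu)=0$, where, for a user-specified $\eta:\{0,1\}\to\mathbb R^k$, $$S(a,y^1,y^2;\omega_1,\omega_2,\nu)=\eta(a)\,\gamma(y^1,y^2;\nu)^{-1}\{y^1-e_1(a;\omega_1)\}\{y^2-e_2(a;\omega_2)\}.$$ Write $g_1(y^2;\omega_1,\nu)=\int h(y,y^2)f_1(y\mid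 a';\omega_1)\gamma(y,y^2;\nu)\,d\mu_1(y)$ and $g_2(y^1;\omega_2,\nu)=\int h(y^1,y)f_2(y\mid a'';\omega_2)\gamma(y^1,y;\nu)\,d\mu_2(y)$, and $$U_1(b)=\frac{I(A=a'')}{\gamma(Y^1,Y^2;\nu)}\{g_1(Y^2;\omega_1,\nu)-b\},\qquad U_2(b)=\frac{I(A=a')}{\gamma(Y^1,Y^2;\nu)}\{g_2(Y^1;\omega_2,\nu)-b\},$$ $$U_{dr}(b,b_1,b_2)=\frac{I(A=a')\,f_2(Y^2\mid a'';\omega_2)}{\gamma(Y^1,Y^2;\nu)\,f_2(Y^2\mid A;\omega_2)}\bigl\{h(Y^1,Y^2)\gamma(Y^1,Y^2;\nu)-b-g_1(Y^2;\omega_1,\nu)+b_1-g_2(Y^1;\omega_2,\nu)+b_2\bigr\}.$$ With $\hat\nu,\tilde\omega_1(\hat\nu),\tilde\omega_2(\hat\nu)$ plugged in, let $\tilde\beta_{h,1}$, $\tilde\beta_{h,2}$ solve $\sum_{i<n}U_{1,i}(\tilde\beta_{h,1})=0$, $\sum_{i<n}U_{2,i}(\tilde\beta_{h,2})=0$, and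 let $\tilde\beta_{h,dr}$ solve $\sum_{i<n}U_{dr,i}(\tilde\beta_{h,dr},\tilde\beta_{h,1},\tilde\beta_{h,2})=0$. It is only required that these maximisation and equation properties hold with probability tending to one as $n\to\infty$. **Regularity.** (R1) The log conditional densities $\log f_1(y^1\mid a,y^2;\omega_1,\nu)$, $\log f_2(y^2\mid a,y^1;\omega_2,\nu)$ and $S$, as functions of an observation and of the parameters, are measurable in the observation, continuous in the parameters for almost every observation, and dominated, uniformly in the parameters, by an integrable function of the observation. (R2) Identifiability of $\nu$ by its estimating equation: at most one $\nu\in N$ has the property that $E\,S(A,Y^1,Y^2;\omega_1,\omega_2,\nu)=0$ for some $\omega_1$ maximising $E\log f_1(Y^1\mid A,Y^2;\cdot,\nu)$ and some $\omega_2$ maximising $E\log f_2(Y^2\mid A,Y^1;\cdot,\nu)$. (R3, for a given $h$) The integrals defining $g_1,g_2$ converge absolutely, and for all real $b,b_1,b_2$ the functions $U_1(b),U_2(b),U_{dr}(b,b_1,b_2)$ satisfy the conditions of (R1). **Theorem.** Assume (R1), (R2) and * (i) $\gamma(\cdot,\cdot;\nu_0)=\gamma$ for some $\nu_0\in N$;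 and * (ii) at least one of the following holds: (ii.a) $f_1(y^1\mid a;\omega_1)=f(y^1\mid a,Y^2=0)$ for some $\omega_1\in\Theta_1$ and all $a,y^1$; (ii.b) $f_2(y^2\mid a;\omega_2)=f(y^2\mid a,Y^1=0)$ for some $\omega_2\in\Theta_2$ and all $a,y^2$. Then, for all $a',a''\in\{0,1\}$: 1. for every measurable $h$ for which the integral defining $\beta_h(a',a'')$ converges absolutely and (R3) holds, $\tilde\beta_{h,dr}\to\beta_h(a',a'')$ in probability as $n\to\infty$; 2. if the integral defining $\beta_{y^1}(a',a'')$ converges absolutely, then $Y^1(a',a'')$ is integrable and $E\{Y^1(a',a'')\}=\psi(a',a'')$; and if moreover (R3) holds for $h=y^1$ and for $h=1$, then $\tilde\beta_{y^1,dr}/\tilde\beta_{1,dr}\to\psi(a',a'')$ in probability. -/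

import Mathlib

open MeasureTheory ProbabilityTheory Filter Topology

noncomputable section

namespace DyadDR

/-- An observation `(a, y¹, y²)` on one dyad: binary treatment and two real outcomes. -/
abbrev Obs := Fin 2 × ℝ × ℝ

/-! ### The law of the potential outcomes and the target functionals -/

section Law

variable (μ₁ μ₂ : Measure ℝ)

/-- Conditional density of the first outcome at `y₁` given that the second one equals `y₂`,
for the joint density `q` with respect to `μ₁ ⊗ μ₂`. -/
def condDens₁ (q : ℝ → ℝ → ℝ) (y₁ y₂ : ℝ) : ℝ := q y₁ y₂ / ∫ y, q y y₂ ∂μ₁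

/-- Conditional density of the second outcome at `y₂` given that the first one equals `y₁`. -/
def condDens₂ (q : ℝ → ℝ → ℝ) (y₁ y₂ : ℝ) : ℝ := q y₁ y₂ / ∫ y, q y₁ y ∂μ₂

/-- The chain graph causal model for one dyad with a split treatment. `Y a' a''` is the pair of
potential outcomes `(Y¹(a', a''), Y²(a', a''))`, with joint density `p a' a''`, and `A` is the
treatment that was assigned. -/
structure ChainGraphModel {Ω : Type*} [MeasurableSpace Ω] (P : Measure Ω)
    (A : Ω → Fin 2) (Y : Fin 2 → Fin 2 → Ω → ℝ × ℝ)
    (p : Fin 2 → Fin 2 → ℝ → ℝ → ℝ) : Prop where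
  measurable_A : Measurable A
  measurable_Y : ∀ a' a'', Measurable (Y a' a'')
  measurable_p : ∀ a' a'', Measurable (Function.uncurry (p a' a''))
  /-- positivity of the block distribution -/
  pos : ∀ a' a'' y₁ y₂, 0 < p a' a'' y₁ y₂
  law : ∀ a' a'', P.map (Y a' a'') =
    (μ₁.prod μ₂).withDensity (fun y => ENNReal.ofReal (p a' a'' y.1 y.2))
  /-- the marginal densities, hence the conditional ones, are finite at every point -/
  slice₁ : ∀ a' a'' y₂, Integrable (fun y₁ => p a' a'' y₁ y₂) μ₁
  slice₂ : ∀ a' a'' y₁, Integrable (fun y₂ => p a' a'' y₁ y₂) μ₂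
  /-- `p{Y¹(a',a'') | Y²(a',a'')}` is a function of `Y¹`, `a'`, `Y²` only -/
  exclusion₁ : ∀ a' a'' b'' y₁ y₂,
    condDens₁ μ₁ (p a' a'') y₁ y₂ = condDens₁ μ₁ (p a' b'') y₁ y₂
  /-- `p{Y²(a',a'') | Y¹(a',a'')}` is a function of `Y²`, `a''`, `Y¹` only -/
  exclusion₂ : ∀ a' b' a'' y₁ y₂,
    condDens₂ μ₂ (p a' a'') y₁ y₂ = condDens₂ μ₂ (p b' a'') y₁ y₂
  /-- the treatment is randomised: `{Y¹(a), Y²(a)} ⊥ A`, where `Y(a) = Y(a, a)` -/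
  randomised : ∀ a, IndepFun A (Y a a) P
  arm_pos : ∀ a, 0 < P (A ⁻¹' {a})

/-- What is observed on a dyad, by consistency: both treatment components equal the assigned
treatment. -/
def observe {Ω : Type*} (A : Ω → Fin 2) (Y : Fin 2 → Fin 2 → Ω → ℝ × ℝ) (ω : Ω) : Obs :=
  (A ω, Y (A ω) (A ω) ω)

/-- `f(y₁ | a, Y² = 0)`. The conditional density of the outcomes given `A = a` is `p a a`. -/
def baseline₁ (p : Fin 2 → Fin 2 → ℝ → ℝ → ℝ) (a : Fin 2) (y₁ : ℝ) : ℝ :=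
  condDens₁ μ₁ (p a a) y₁ 0

/-- `f(y₂ | a, Y¹ = 0)`. -/
def baseline₂ (p : Fin 2 → Fin 2 → ℝ → ℝ → ℝ) (a : Fin 2) (y₂ : ℝ) : ℝ :=
  condDens₂ μ₂ (p a a) 0 y₂

/-- The odds ratio function `γ(y₁, y₂)`. It is written in the arm `a = 0`; the two exclusion
restrictions make it the same in both arms. -/
def oddsRatio (p : Fin 2 → Fin 2 → ℝ → ℝ → ℝ) (y₁ y₂ : ℝ) : ℝ :=
  p 0 0 y₁ y₂ * p 0 0 0 0 / (p 0 0 y₁ 0 * p 0 0 0 y₂)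

/-- The integrand `h(y₁,y₂) f(y₁ | a', Y² = 0) γ(y₁,y₂) f(y₂ | a'', Y¹ = 0)` of `β_h`. -/
def betaIntegrand (p : Fin 2 → Fin 2 → ℝ → ℝ → ℝ) (h : ℝ → ℝ → ℝ) (a' a'' : Fin 2)
    (y : ℝ × ℝ) : ℝ :=
  h y.1 y.2 * baseline₁ μ₁ p a' y.1 * oddsRatio p y.1 y.2 * baseline₂ μ₂ p a'' y.2

/-- `β_h(a', a'')`. -/
def beta (p : Fin 2 → Fin 2 → ℝ → ℝ → ℝ) (h : ℝ → ℝ → ℝ) (a' a'' : Fin 2) : ℝ :=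
  ∫ y, betaIntegrand μ₁ μ₂ p h a' a'' y ∂(μ₁.prod μ₂)

/-- `ψ(a', a'') = β_{y¹}(a', a'') / β_1(a', a'')`. -/
def psi (p : Fin 2 → Fin 2 → ℝ → ℝ → ℝ) (a' a'' : Fin 2) : ℝ :=
  beta μ₁ μ₂ p (fun y₁ _ => y₁) a' a'' / beta μ₁ μ₂ p (fun _ _ => 1) a' a''

end Law

/-! ### The parametric models, the estimating functions and the estimators -/

/-- Parametric models `f(y₁ | a, Y² = 0; ω₁)`, `f(y₂ | a, Y¹ = 0; ω₂)`, `γ(y₁, y₂; ν)`,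
with parameters in `Θ₁`, `Θ₂`, `N`. None of them is supposed to be correct. -/
structure ParametricModel (μ₁ μ₂ : Measure ℝ) (Θ₁ Θ₂ N : Type*) where
  f₁ : Fin 2 → ℝ → Θ₁ → ℝ
  f₂ : Fin 2 → ℝ → Θ₂ → ℝ
  γ : ℝ → ℝ → N → ℝ
  measurable_f₁ : ∀ a ω₁, Measurable (fun y => f₁ a y ω₁)
  measurable_f₂ : ∀ a ω₂, Measurable (fun y => f₂ a y ω₂)
  measurable_γ : ∀ ν, Measurable (fun y : ℝ × ℝ => γ y.1 y.2 ν)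
  f₁_pos : ∀ a y ω₁, 0 < f₁ a y ω₁
  f₂_pos : ∀ a y ω₂, 0 < f₂ a y ω₂
  γ_pos : ∀ y₁ y₂ ν, 0 < γ y₁ y₂ ν
  f₁_integral : ∀ a ω₁, ∫ y, f₁ a y ω₁ ∂μ₁ = 1
  f₂_integral : ∀ a ω₂, ∫ y, f₂ a y ω₂ ∂μ₂ = 1
  /-- finite first moments -/
  f₁_moment : ∀ a ω₁, Integrable (fun y => y * f₁ a y ω₁) μ₁
  f₂_moment : ∀ a ω₂, Integrable (fun y => y * f₂ a y ω₂) μ₂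
  /-- finite normalising constants of the conditional densities -/
  norm₁ : ∀ a y₂ ω₁ ν, Integrable (fun y => f₁ a y ω₁ * γ y y₂ ν) μ₁
  norm₂ : ∀ a y₁ ω₂ ν, Integrable (fun y => f₂ a y ω₂ * γ y₁ y ν) μ₂

namespace ParametricModel

variable {μ₁ μ₂ : Measure ℝ} {Θ₁ Θ₂ N : Type*} (M : ParametricModel μ₁ μ₂ Θ₁ Θ₂ N)

/-- `f(y₁ | a, y₂; ω₁, ν)`. -/
def cond₁ (x : Obs) (ω₁ : Θ₁) (ν : N) : ℝ :=
  M.f₁ x.1 x.2.1 ω₁ * M.γ x.2.1 x.2.2 ν / ∫ y, M.f₁ x.1 y ω₁ * M.γ y x.2.2 ν ∂μ₁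

/-- `f(y₂ | a, y₁; ω₂, ν)`. -/
def cond₂ (x : Obs) (ω₂ : Θ₂) (ν : N) : ℝ :=
  M.f₂ x.1 x.2.2 ω₂ * M.γ x.2.1 x.2.2 ν / ∫ y, M.f₂ x.1 y ω₂ * M.γ x.2.1 y ν ∂μ₂

/-- `E{Y¹ | a, Y² = 0; ω₁}`. -/
def mean₁ (a : Fin 2) (ω₁ : Θ₁) : ℝ := ∫ y, y * M.f₁ a y ω₁ ∂μ₁

/-- `E{Y² | a, Y¹ = 0; ω₂}`. -/
def mean₂ (a : Fin 2) (ω₂ : Θ₂) : ℝ := ∫ y, y * M.f₂ a y ω₂ ∂μ₂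

/-- The doubly robust estimating function for `ν`, with the user-specified index function `η`. -/
def nuScore {k : ℕ} (η : Fin 2 → EuclideanSpace ℝ (Fin k)) (x : Obs)
    (ω₁ : Θ₁) (ω₂ : Θ₂) (ν : N) : EuclideanSpace ℝ (Fin k) :=
  ((M.γ x.2.1 x.2.2 ν)⁻¹ * (x.2.1 - M.mean₁ x.1 ω₁) * (x.2.2 - M.mean₂ x.1 ω₂)) • η x.1

/-- `∑_{y¹} h(y¹, y₂) f(y¹ | a', Y² = 0; ω₁) γ(y¹, y₂; ν)`. -/
def inner₁ (h : ℝ → ℝ → ℝ) (a' : Fin 2) (y₂ : ℝ) (ω₁ : Θ₁) (ν : N) : ℝ :=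
  ∫ y, h y y₂ * M.f₁ a' y ω₁ * M.γ y y₂ ν ∂μ₁

/-- `∑_{y²} h(y₁, y²) f(y² | a'', Y¹ = 0; ω₂) γ(y₁, y²; ν)`. -/
def inner₂ (h : ℝ → ℝ → ℝ) (a'' : Fin 2) (y₁ : ℝ) (ω₂ : Θ₂) (ν : N) : ℝ :=
  ∫ y, h y₁ y * M.f₂ a'' y ω₂ * M.γ y₁ y ν ∂μ₂

/-- The estimating function `U₁`. -/
def U₁ (h : ℝ → ℝ → ℝ) (a' a'' : Fin 2) (b : ℝ) (x : Obs) (ω₁ : Θ₁) (ν : N) : ℝ :=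
  (if x.1 = a'' then 1 else 0) / M.γ x.2.1 x.2.2 ν * (M.inner₁ h a' x.2.2 ω₁ ν - b)

/-- The estimating function `U₂`. -/
def U₂ (h : ℝ → ℝ → ℝ) (a' a'' : Fin 2) (b : ℝ) (x : Obs) (ω₂ : Θ₂) (ν : N) : ℝ :=
  (if x.1 = a' then 1 else 0) / M.γ x.2.1 x.2.2 ν * (M.inner₂ h a'' x.2.1 ω₂ ν - b)

/-- The estimating function `U_dr`; `b`, `b₁`, `b₂` are the values put in for the doubly robust
estimator and for the two estimators based on `U₁` and `U₂`. -/
def Udr (h : ℝ → ℝ → ℝ) (a' a'' : Fin 2) (b b₁ b₂ : ℝ) (x : Obs)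
    (ω₁ : Θ₁) (ω₂ : Θ₂) (ν : N) : ℝ :=
  (if x.1 = a' then 1 else 0) * M.f₂ a'' x.2.2 ω₂
      / (M.γ x.2.1 x.2.2 ν * M.f₂ x.1 x.2.2 ω₂)
    * (h x.2.1 x.2.2 * M.γ x.2.1 x.2.2 ν - b
        - M.inner₁ h a' x.2.2 ω₁ ν + b₁
        - M.inner₂ h a'' x.2.1 ω₂ ν + b₂)

/-- On the sample `x 0, …, x (n - 1)`: `w₁ ν` and `w₂ ν` are conditional maximum likelihood
estimators of `ω₁` and `ω₂` for each fixed `ν`, and `νhat` solves the doubly robust estimating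
equation for `ν` with these plugged in. -/
structure NuisanceSolution {k : ℕ} (η : Fin 2 → EuclideanSpace ℝ (Fin k)) (x : ℕ → Obs) (n : ℕ)
    (w₁ : N → Θ₁) (w₂ : N → Θ₂) (νhat : N) : Prop where
  mle₁ : ∀ ν ω₁, ∑ i ∈ Finset.range n, Real.log (M.cond₁ (x i) ω₁ ν) ≤
    ∑ i ∈ Finset.range n, Real.log (M.cond₁ (x i) (w₁ ν) ν)
  mle₂ : ∀ ν ω₂, ∑ i ∈ Finset.range n, Real.log (M.cond₂ (x i) ω₂ ν) ≤
    ∑ i ∈ Finset.range n, Real.log (M.cond₂ (x i) (w₂ ν) ν)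
  score : ∑ i ∈ Finset.range n, M.nuScore η (x i) (w₁ νhat) (w₂ νhat) νhat = 0

/-- On the sample `x 0, …, x (n - 1)`, with estimated nuisance parameters `ω₁`, `ω₂`, `ν`: the
numbers `b₁`, `b₂` and `b` solve the estimating equations of `U₁`, `U₂` and `U_dr`. -/
structure BetaSolution (h : ℝ → ℝ → ℝ) (a' a'' : Fin 2) (x : ℕ → Obs) (n : ℕ)
    (ω₁ : Θ₁) (ω₂ : Θ₂) (ν : N) (b₁ b₂ b : ℝ) : Prop where
  eq₁ : ∑ i ∈ Finset.range n, M.U₁ h a' a'' b₁ (x i) ω₁ ν = 0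
  eq₂ : ∑ i ∈ Finset.range n, M.U₂ h a' a'' b₂ (x i) ω₂ ν = 0
  eq_dr : ∑ i ∈ Finset.range n, M.Udr h a' a'' b b₁ b₂ (x i) ω₁ ω₂ ν = 0

end ParametricModel

/-! ### Regularity conditions -/

/-- The usual regularity of a parametric family of functions of one observation with law `Q`:
measurable in the observation, continuous in the parameter, dominated by an integrable function. -/
structure RegularFamily (Q : Measure Obs) {T E : Type*} [TopologicalSpace T]
    [NormedAddCommGroup E] (F : Obs → T → E) : Prop where
  meas : ∀ t, AEStronglyMeasurable (fun x => F x t) Q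
  cont : ∀ᵐ x ∂Q, Continuous (F x)
  envelope : ∃ G : Obs → ℝ, Integrable G Q ∧ ∀ᵐ x ∂Q, ∀ t, ‖F x t‖ ≤ G x

namespace ParametricModel

variable {μ₁ μ₂ : Measure ℝ} {Θ₁ Θ₂ N : Type*} (M : ParametricModel μ₁ μ₂ Θ₁ Θ₂ N)

/-- `ω₁` maximises the population conditional log-likelihood at `ν`, under the law `Q`. -/
def PopMax₁ (Q : Measure Obs) (ν : N) (ω₁ : Θ₁) : Prop :=
  ∀ ω, ∫ x, Real.log (M.cond₁ x ω ν) ∂Q ≤ ∫ x, Real.log (M.cond₁ x ω₁ ν) ∂Q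

/-- `ω₂` maximises the population conditional log-likelihood at `ν`, under the law `Q`. -/
def PopMax₂ (Q : Measure Obs) (ν : N) (ω₂ : Θ₂) : Prop :=
  ∀ ω, ∫ x, Real.log (M.cond₂ x ω ν) ∂Q ≤ ∫ x, Real.log (M.cond₂ x ω₂ ν) ∂Q

/-- `ν` is a root of the population version of the estimating equation for `ν`. -/
def PopRoot {k : ℕ} (η : Fin 2 → EuclideanSpace ℝ (Fin k)) (Q : Measure Obs) (ν : N) : Prop :=
  ∃ ω₁ ω₂, M.PopMax₁ Q ν ω₁ ∧ M.PopMax₂ Q ν ω₂ ∧ ∫ x, M.nuScore η x ω₁ ω₂ ν ∂Q = 0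

/-- Regularity for the estimation of the nuisance parameters; `unique_root` is the
identifiability of `ν` by its estimating equation. -/
structure NuisanceRegular [TopologicalSpace Θ₁] [TopologicalSpace Θ₂] [TopologicalSpace N]
    {k : ℕ} (η : Fin 2 → EuclideanSpace ℝ (Fin k)) (Q : Measure Obs) : Prop where
  loglik₁ : RegularFamily Q (fun x (t : Θ₁ × N) => Real.log (M.cond₁ x t.1 t.2))
  loglik₂ : RegularFamily Q (fun x (t : Θ₂ × N) => Real.log (M.cond₂ x t.1 t.2))
  score : RegularFamily Q (fun x (t : Θ₁ × Θ₂ × N) => M.nuScore η x t.1 t.2.1 t.2.2)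
  unique_root : ∀ ν ν', M.PopRoot η Q ν → M.PopRoot η Q ν' → ν = ν'

/-- Regularity for the estimation of `β_h(a', a'')`: the integrals that enter the estimating
functions are finite, and the estimating functions are regular families. -/
structure BetaRegular [TopologicalSpace Θ₁] [TopologicalSpace Θ₂] [TopologicalSpace N]
    (h : ℝ → ℝ → ℝ) (a' a'' : Fin 2) (Q : Measure Obs) : Prop where
  integrable₁ : ∀ y₂ ω₁ ν, Integrable (fun y => h y y₂ * M.f₁ a' y ω₁ * M.γ y y₂ ν) μ₁
  integrable₂ : ∀ y₁ ω₂ ν, Integrable (fun y => h y₁ y * M.f₂ a'' y ω₂ * M.γ y₁ y ν) μ₂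
  reg₁ : ∀ b, RegularFamily Q (fun x (t : Θ₁ × N) => M.U₁ h a' a'' b x t.1 t.2)
  reg₂ : ∀ b, RegularFamily Q (fun x (t : Θ₂ × N) => M.U₂ h a' a'' b x t.1 t.2)
  reg_dr : ∀ b b₁ b₂, RegularFamily Q
    (fun x (t : Θ₁ × Θ₂ × N) => M.Udr h a' a'' b b₁ b₂ x t.1 t.2.1 t.2.2)

end ParametricModel

end DyadDR

end

/-! The exclusion restrictions let the odds ratio be written through either conditional density, so
it is common to all `(a', a'')`, and every joint density factors as `p a' a'' = C · f₁(y₁ | a')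
γ(y₁, y₂) f₂(y₂ | a'')` with baselines taken from the observed arms. By randomisation the observed
law is, arm by arm, a positive multiple of `f₁ γ f₂`. Each estimating function carries a factor
`1/γ`, which at the true odds ratio turns an arm into a product measure; double robustness is then
Fubini.

Nuisance parameters. In each arm the mean of the score factors into two centred integrals, one of
which vanishes when either baseline is correct. By Gibbs' inequality a correct baseline maximises
the population conditional likelihood, so `ν₀` is a population root (`ObservedLaw.popRoot`), and by
identifiability the only one. Any other maximiser of a correct model has the same conditional
density almost everywhere, hence the same baseline (`ae_eq_of_popMax₁`).

The functional. The equations are affine in the unknowns, and the population root of `U_dr` is `β₁ +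
β₂ + u/(u - v)`, where `β₁`, `β₂` are the roots for `U₁`, `U₂` and `u`, `v` are the means of `U_dr`
at `b = 0` and `b = 1` with `b₁ = b₂ = 0`. If `f₁` is correct, then `β₁ = β_h` and the last term is
`-β₂`; if `f₂` is correct, the roles are exchanged (`population_beta`).

Sampling. A strong law in the Banach space of continuous functions of the parameter
(`RegularFamily.strong_law`) shows that limit points of the estimators solve the population
equations. A misspecified baseline may have many maximisers, so its estimator need not converge. By
compactness every subsequence has a further one along which the nuisance estimators do converge, and
each such limit yields the same `β_h`. Finally `C β_1 = 1`, which makes `ψ` the mean of the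
potential outcome. -/

noncomputable section

namespace DyadDR


/-! ### Uniform strong law over a compact parameter space -/

section UniformLaw

variable {T E : Type*} [MetricSpace T] [NormedAddCommGroup E]

/-- A family of functions of an observation, as a random continuous function of the parameter. -/
def toContinuousMap {X : Type*} (F : X → T → E) (x : X) : C(T, E) :=
  -- The value `0` is used only on the null set of observations whose path is discontinuous.
  open Classical in if h : Continuous (F x) then ⟨F x, h⟩ else 0

lemma toContinuousMap_apply {X : Type*} {F : X → T → E} {x : X} (h : Continuous (F x)) (t : T) :
    toContinuousMap F x t = F x t := by
  simp [toContinuousMap, h]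

/-- A random continuous function on a compact space is measurable once its values are. -/
lemma aemeasurable_continuousMap_of_eval [CompactSpace T]
    [CompleteSpace E] [SecondCountableTopology E] {X : Type*} [MeasurableSpace X] {Q : Measure X}
    [MeasurableSpace C(T, E)] [BorelSpace C(T, E)] {Φ : X → C(T, E)}
    (h : ∀ t, AEStronglyMeasurable (fun x => Φ x t) Q) : AEMeasurable Φ Q := by
  borelize E
  obtain ⟨D, hDc, hDd⟩ := TopologicalSpace.exists_countable_dense T
  have : Countable D := hDc
  -- Restriction to a countable dense set is a continuous injection of a Polish space into a
  -- countable product of copies of `E`, hence a measurable embedding. So countably many evaluations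
  -- decide measurability.
  let r : C(T, E) → (D → E) := fun f d => f d
  have hr : Continuous r := continuous_pi fun d => continuous_eval_const _
  have hinj : Function.Injective r := by
    intro f g hfg
    refine ContinuousMap.coe_injective ?_
    exact Continuous.ext_on hDd f.continuous g.continuous fun d hd => congrFun hfg ⟨d, hd⟩
  have : PolishSpace C(T, E) := inferInstance
  rw [← (hr.measurableEmbedding hinj).aemeasurable_comp_iff, aemeasurable_pi_iff]
  exact fun d => (h d).aemeasurable

lemma RegularFamily.integrable {Q : Measure Obs} {F : Obs → T → E} (hF : RegularFamily Q F)
    (t : T) : Integrable (fun x => F x t) Q := by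
  obtain ⟨G, hG, hb⟩ := hF.envelope
  exact hG.mono' (hF.meas t) (hb.mono fun x hx => hx t)

lemma RegularFamily.continuous_integral [NormedSpace ℝ E] {Q : Measure Obs} {F : Obs → T → E}
    (hF : RegularFamily Q F) : Continuous fun t => ∫ x, F x t ∂Q := by
  obtain ⟨G, hG, hb⟩ := hF.envelope
  exact continuous_of_dominated hF.meas (fun t => hb.mono fun x hx => hx t) hG hF.cont

/-- Uniform strong law of large numbers, along sequences of parameters. -/
theorem RegularFamily.strong_law [CompactSpace T] [NormedSpace ℝ E] [CompleteSpace E]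
    [SecondCountableTopology E] {Ω : Type*} [MeasurableSpace Ω] {P : Measure Ω}
    {X : ℕ → Ω → Obs} (hindep : Pairwise fun i j => IndepFun (X i) (X j) P)
    (hident : ∀ i, IdentDistrib (X i) (X 0) P P) {F : Obs → T → E}
    (hF : RegularFamily (P.map (X 0)) F) :
    ∀ᵐ ω ∂P, ∀ (ns : ℕ → ℕ) (t : ℕ → T) (t₀ : T), Tendsto ns atTop atTop →
      Tendsto t atTop (𝓝 t₀) →
      Tendsto (fun k => (ns k : ℝ)⁻¹ • ∑ i ∈ Finset.range (ns k), F (X i ω) (t k)) atTop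
        (𝓝 (∫ x, F x t₀ ∂(P.map (X 0)))) := by
  borelize C(T, E)
  set Q := P.map (X 0) with hQ
  have heval : ∀ t, (fun x => toContinuousMap F x t) =ᵐ[Q] fun x => F x t := fun t =>
    hF.cont.mono fun x hx => toContinuousMap_apply hx t
  have hmeas : AEMeasurable (toContinuousMap F) Q :=
    aemeasurable_continuousMap_of_eval fun t => (hF.meas t).congr (heval t).symm
  have hint : Integrable (toContinuousMap F) Q := by
    obtain ⟨G, hG, hb⟩ := hF.envelope
    refine hG.norm.mono' hmeas.aestronglyMeasurable ?_
    filter_upwards [hF.cont, hb] with x hx hbx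
    refine (ContinuousMap.norm_le _ (norm_nonneg _)).2 fun t => ?_
    rw [toContinuousMap_apply hx]
    exact (hbx t).trans (le_abs_self _)
  -- A truly measurable version is needed so that independence and equality in law pass to `Φ (X i)`
  -- by composition.
  set Φ := hmeas.mk (toContinuousMap F) with hΦ
  have hΦm : Measurable Φ := hmeas.measurable_mk
  have hΦe : ∀ᵐ x ∂Q, Continuous (F x) ∧ toContinuousMap F x = Φ x :=
    hF.cont.and hmeas.ae_eq_mk
  have hΦi : Integrable Φ Q := hint.congr hmeas.ae_eq_mk
  have hlim := strong_law_ae (fun i ω => Φ (X i ω)) (μ := P)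
    ((integrable_map_measure hΦm.aestronglyMeasurable (hident 0).aemeasurable_fst).1 hΦi)
    (fun i j hij => (hindep hij).comp hΦm hΦm) (fun i => (hident i).comp hΦm)
  have hae : ∀ᵐ ω ∂P, ∀ i, Continuous (F (X i ω)) ∧ toContinuousMap F (X i ω) = Φ (X i ω) := by
    refine ae_all_iff.2 fun i => ?_
    have h := hΦe
    rw [hQ, ← (hident i).map_eq] at h
    exact ae_of_ae_map (hident i).aemeasurable_fst h
  have hI : ∀ t, (∫ ω, Φ (X 0 ω) ∂P) t = ∫ x, F x t ∂Q := by
    intro t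
    have h1 : ∫ ω, Φ (X 0 ω) ∂P = ∫ x, Φ x ∂Q :=
      (integral_map (hident 0).aemeasurable_fst hΦm.aestronglyMeasurable).symm
    rw [h1, ContinuousMap.integral_apply hΦi]
    refine integral_congr_ae ?_
    filter_upwards [hΦe] with x hx
    rw [← hx.2, toContinuousMap_apply hx.1]
  filter_upwards [hlim, hae] with ω h1 h2 ns t t₀ hns ht
  -- Evaluation is jointly continuous on `C(T, E) × T`, so convergence in sup norm allows a moving
  -- parameter.
  have h3 : Tendsto (fun k => ((ns k : ℝ)⁻¹ • ∑ i ∈ Finset.range (ns k), Φ (X i ω)) (t k)) atTop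
      (𝓝 ((∫ ω, Φ (X 0 ω) ∂P) t₀)) :=
    (ContinuousEval.continuous_eval.tendsto (_, t₀)).comp ((h1.comp hns).prodMk_nhds ht)
  rw [hI] at h3
  refine h3.congr fun k => ?_
  simp only [ContinuousMap.coe_smul, ContinuousMap.coe_sum, Pi.smul_apply, Finset.sum_apply]
  congr 1
  refine Finset.sum_congr rfl fun i _ => ?_
  rw [← (h2 i).2, toContinuousMap_apply (h2 i).1]

end UniformLaw


/-! ### Factorisation of the densities and the observed law -/

section ObservedLaw

/-- A law of one observation whose two arms are mixtures, with positive weights, of densities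
that factor as `f₁(y₁ | a) γ(y₁, y₂) f₂(y₂ | a)`. -/
structure ObservedLaw (μ₁ μ₂ : Measure ℝ) (Q : Measure Obs) (f₁ f₂ : Fin 2 → ℝ → ℝ)
    (γ : ℝ → ℝ → ℝ) (π : Fin 2 → ℝ) : Prop where
  measurable_f₁ : ∀ a, Measurable (f₁ a)
  measurable_f₂ : ∀ a, Measurable (f₂ a)
  measurable_γ : Measurable (Function.uncurry γ)
  f₁_pos : ∀ a y, 0 < f₁ a y
  f₂_pos : ∀ a y, 0 < f₂ a y
  γ_pos : ∀ y z, 0 < γ y z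
  f₁_integral : ∀ a, ∫ y, f₁ a y ∂μ₁ = 1
  f₂_integral : ∀ a, ∫ y, f₂ a y ∂μ₂ = 1
  weight_pos : ∀ a, 0 < π a
  law : Q = ∑ a, ENNReal.ofReal (π a) • (((μ₁.prod μ₂).withDensity fun y =>
    ENNReal.ofReal (f₁ a y.1 * γ y.1 y.2 * f₂ a y.2)).map (Prod.mk a))

variable {Ω : Type*} [MeasurableSpace Ω] {P : Measure Ω} {μ₁ μ₂ : Measure ℝ}
  {A : Ω → Fin 2} {Y : Fin 2 → Fin 2 → Ω → ℝ × ℝ} {p : Fin 2 → Fin 2 → ℝ → ℝ → ℝ}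

lemma integral_pos_of_pos {X : Type*} [MeasurableSpace X] {μ : Measure X} (hμ : μ ≠ 0)
    {f : X → ℝ} (hf : ∀ x, 0 < f x) (hi : Integrable f μ) : 0 < ∫ x, f x ∂μ := by
  rw [integral_pos_iff_support_of_nonneg (fun x => (hf x).le) hi]
  have : Function.support f = Set.univ := by
    ext x; simp [(hf x).ne']
  rw [this]
  exact Measure.measure_univ_pos.2 hμ

namespace ChainGraphModel

lemma prod_ne_zero [IsProbabilityMeasure P] (hm : ChainGraphModel μ₁ μ₂ P A Y p) :
    μ₁.prod μ₂ ≠ 0 := by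
  intro h
  have h1 := hm.law 0 0
  have := Measure.isProbabilityMeasure_map (μ := P) (hm.measurable_Y 0 0).aemeasurable
  have h2 : (P.map (Y 0 0)) Set.univ = 1 := measure_univ
  rw [h1, h] at h2
  simp at h2

lemma ne_zero₁ [IsProbabilityMeasure P] [SFinite μ₁] [SFinite μ₂]
    (hm : ChainGraphModel μ₁ μ₂ P A Y p) : μ₁ ≠ 0 := by
  rintro rfl
  exact hm.prod_ne_zero (by simp)

lemma ne_zero₂ [IsProbabilityMeasure P] [SFinite μ₁] [SFinite μ₂]
    (hm : ChainGraphModel μ₁ μ₂ P A Y p) : μ₂ ≠ 0 := by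
  rintro rfl
  exact hm.prod_ne_zero (by simp)

lemma measurable_observe (hA : Measurable A) (hY : ∀ a, Measurable (Y a a)) :
    Measurable (observe A Y) := by
  have h : Measurable fun z : Fin 2 × Ω => Y z.1 z.1 z.2 :=
    measurable_from_prod_countable_right fun a => hY a
  exact hA.prodMk (h.comp (hA.prodMk measurable_id))

/-- In arm `a` the observed pair is `Y a a`, and randomisation gives it its unconditional law there.
-/
lemma map_observe (hm : ChainGraphModel μ₁ μ₂ P A Y p) :
    P.map (observe A Y) = ∑ a, P (A ⁻¹' {a}) • (((μ₁.prod μ₂).withDensity fun y =>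
      ENNReal.ofReal (p a a y.1 y.2)).map (Prod.mk a)) := by
  ext s hs
  rw [Measure.map_apply (measurable_observe hm.measurable_A fun a => hm.measurable_Y a a) hs]
  have hdec : observe A Y ⁻¹' s = ⋃ a, A ⁻¹' {a} ∩ Y a a ⁻¹' (Prod.mk a ⁻¹' s) := by
    ext ω
    simp [observe]
  rw [hdec, measure_iUnion, tsum_fintype]
  · simp only [Measure.coe_finsetSum, Finset.sum_apply, Measure.coe_smul, Pi.smul_apply,
      smul_eq_mul]
    refine Finset.sum_congr rfl fun a _ => ?_
    have hsa : MeasurableSet (Prod.mk a ⁻¹' s) := measurable_prodMk_left hs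
    rw [(hm.randomised a).measure_inter_preimage_eq_mul _ _ (measurableSet_singleton a) hsa,
      Measure.map_apply measurable_prodMk_left hs, ← hm.law a a,
      Measure.map_apply (hm.measurable_Y a a) hsa]
  · intro a b hab
    refine Set.disjoint_left.2 ?_
    rintro ω ⟨h1, -⟩ ⟨h2, -⟩
    exact hab (h1.symm.trans h2)
  · intro a
    exact (hm.measurable_A (measurableSet_singleton a)).inter
      (hm.measurable_Y a a (measurable_prodMk_left hs))

lemma slice₁_pos [IsProbabilityMeasure P] [SFinite μ₁] [SFinite μ₂]
    (hm : ChainGraphModel μ₁ μ₂ P A Y p) (a' a'' : Fin 2) (y₂ : ℝ) :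
    0 < ∫ y, p a' a'' y y₂ ∂μ₁ :=
  integral_pos_of_pos hm.ne_zero₁ (fun _ => hm.pos _ _ _ _) (hm.slice₁ _ _ _)

lemma slice₂_pos [IsProbabilityMeasure P] [SFinite μ₁] [SFinite μ₂]
    (hm : ChainGraphModel μ₁ μ₂ P A Y p) (a' a'' : Fin 2) (y₁ : ℝ) :
    0 < ∫ y, p a' a'' y₁ y ∂μ₂ :=
  integral_pos_of_pos hm.ne_zero₂ (fun _ => hm.pos _ _ _ _) (hm.slice₂ _ _ _)

/-- The first exclusion restriction, without denominators. -/
lemma exclusion_mul₁ [IsProbabilityMeasure P] [SFinite μ₁] [SFinite μ₂]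
    (hm : ChainGraphModel μ₁ μ₂ P A Y p) (a' a'' b'' : Fin 2) (y₁ z₁ y₂ : ℝ) :
    p a' a'' y₁ y₂ * p a' b'' z₁ y₂ = p a' b'' y₁ y₂ * p a' a'' z₁ y₂ := by
  have h1 := hm.exclusion₁ a' a'' b'' y₁ y₂
  have h2 := hm.exclusion₁ a' a'' b'' z₁ y₂
  have h3 := hm.slice₁_pos a' a'' y₂
  have h4 := hm.slice₁_pos a' b'' y₂
  unfold condDens₁ at h1 h2
  rw [div_eq_div_iff h3.ne' h4.ne'] at h1 h2
  refine mul_right_cancel₀ (mul_pos h3 h4).ne' ?_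
  linear_combination (p a' b'' z₁ y₂ * ∫ y, p a' a'' y y₂ ∂μ₁) * h1 -
    (p a' b'' y₁ y₂ * ∫ y, p a' a'' y y₂ ∂μ₁) * h2

/-- The second exclusion restriction, without denominators. -/
lemma exclusion_mul₂ [IsProbabilityMeasure P] [SFinite μ₁] [SFinite μ₂]
    (hm : ChainGraphModel μ₁ μ₂ P A Y p) (a' b' a'' : Fin 2) (y₁ y₂ z₂ : ℝ) :
    p a' a'' y₁ y₂ * p b' a'' y₁ z₂ = p b' a'' y₁ y₂ * p a' a'' y₁ z₂ := by
  have h1 := hm.exclusion₂ a' b' a'' y₁ y₂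
  have h2 := hm.exclusion₂ a' b' a'' y₁ z₂
  have h3 := hm.slice₂_pos a' a'' y₁
  have h4 := hm.slice₂_pos b' a'' y₁
  unfold condDens₂ at h1 h2
  rw [div_eq_div_iff h3.ne' h4.ne'] at h1 h2
  refine mul_right_cancel₀ (mul_pos h3 h4).ne' ?_
  linear_combination (p b' a'' y₁ z₂ * ∫ y, p a' a'' y₁ y ∂μ₂) * h1 -
    (p b' a'' y₁ y₂ * ∫ y, p a' a'' y₁ y ∂μ₂) * h2

/-- The odds ratio is the same for all values of the split treatment. -/
lemma density_eq_oddsRatio [IsProbabilityMeasure P] [SFinite μ₁] [SFinite μ₂]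
    (hm : ChainGraphModel μ₁ μ₂ P A Y p) (a' a'' : Fin 2) (y₁ y₂ : ℝ) :
    p a' a'' y₁ y₂ * p a' a'' 0 0 = oddsRatio p y₁ y₂ * (p a' a'' y₁ 0 * p a' a'' 0 y₂) := by
  have hp := fun a b y z => (hm.pos a b y z).ne'
  -- The conditional density of the first outcome is free of `a''`, so `key₁` moves `a''` to `0`;
  -- that of the second is free of `a'`, so `key₂` then moves `a'` to `0`.
  have key₁ : ∀ b'', p a' a'' y₁ y₂ * p a' a'' 0 0 / (p a' a'' y₁ 0 * p a' a'' 0 y₂) =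
      p a' b'' y₁ y₂ * p a' b'' 0 0 / (p a' b'' y₁ 0 * p a' b'' 0 y₂) := by
    intro b''
    rw [div_eq_div_iff (mul_ne_zero (hp _ _ _ _) (hp _ _ _ _))
      (mul_ne_zero (hp _ _ _ _) (hp _ _ _ _))]
    have h1 := hm.exclusion_mul₁ a' a'' b'' y₁ 0 y₂
    have h2 := hm.exclusion_mul₁ a' a'' b'' y₁ 0 0
    linear_combination (p a' a'' 0 0 * p a' b'' y₁ 0) * h1 -
      (p a' b'' y₁ y₂ * p a' a'' 0 y₂) * h2
  have key₂ : ∀ b', p a' 0 y₁ y₂ * p a' 0 0 0 / (p a' 0 y₁ 0 * p a' 0 0 y₂) =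
      p b' 0 y₁ y₂ * p b' 0 0 0 / (p b' 0 y₁ 0 * p b' 0 0 y₂) := by
    intro b'
    rw [div_eq_div_iff (mul_ne_zero (hp _ _ _ _) (hp _ _ _ _))
      (mul_ne_zero (hp _ _ _ _) (hp _ _ _ _))]
    have h1 := hm.exclusion_mul₂ a' b' 0 y₁ y₂ 0
    have h2 := hm.exclusion_mul₂ a' b' 0 0 y₂ 0
    linear_combination (p a' 0 0 0 * p b' 0 0 y₂) * h1 - (p b' 0 y₁ y₂ * p a' 0 y₁ 0) * h2
  have h := (key₁ 0).trans (key₂ 0)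
  rw [div_eq_iff (mul_ne_zero (hp _ _ _ _) (hp _ _ _ _))] at h
  exact h

/-- The normalising constant that relates `p a' a''` to the product of the baseline densities and
the odds ratio. -/
lemma exists_density_eq [IsProbabilityMeasure P] [SFinite μ₁] [SFinite μ₂]
    (hm : ChainGraphModel μ₁ μ₂ P A Y p) (a' a'' : Fin 2) :
    ∃ C : ℝ, 0 < C ∧ ∀ y₁ y₂, p a' a'' y₁ y₂ =
      C * (baseline₁ μ₁ p a' y₁ * oddsRatio p y₁ y₂ * baseline₂ μ₂ p a'' y₂) := by
  have h1 := hm.slice₁_pos a' a'' 0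
  have h2 := hm.slice₂_pos a' a'' 0
  have h0 := hm.pos a' a'' 0 0
  -- Solving the odds ratio for `p a' a'' y₁ y₂` leaves `1 / p a' a'' 0 0`; the two integrals undo
  -- the normalisation of the baselines.
  refine ⟨(∫ y, p a' a'' y 0 ∂μ₁) * (∫ y, p a' a'' 0 y ∂μ₂) / p a' a'' 0 0, by positivity, ?_⟩
  intro y₁ y₂
  -- The baselines live in the arms `(a', a')` and `(a'', a'')`; exclusion carries both to `(a',
  -- a'')`.
  rw [baseline₁, baseline₂, hm.exclusion₁ a' a' a'', hm.exclusion₂ a'' a' a'', condDens₁,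
    condDens₂]
  have := hm.density_eq_oddsRatio a' a'' y₁ y₂
  field_simp
  linear_combination this

lemma baseline₁_pos [IsProbabilityMeasure P] [SFinite μ₁] [SFinite μ₂]
    (hm : ChainGraphModel μ₁ μ₂ P A Y p) (a : Fin 2) (y : ℝ) : 0 < baseline₁ μ₁ p a y :=
  div_pos (hm.pos _ _ _ _) (hm.slice₁_pos _ _ _)

lemma baseline₂_pos [IsProbabilityMeasure P] [SFinite μ₁] [SFinite μ₂]
    (hm : ChainGraphModel μ₁ μ₂ P A Y p) (a : Fin 2) (y : ℝ) : 0 < baseline₂ μ₂ p a y :=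
  div_pos (hm.pos _ _ _ _) (hm.slice₂_pos _ _ _)

lemma oddsRatio_pos (hm : ChainGraphModel μ₁ μ₂ P A Y p) (y₁ y₂ : ℝ) :
    0 < oddsRatio p y₁ y₂ :=
  div_pos (mul_pos (hm.pos _ _ _ _) (hm.pos _ _ _ _)) (mul_pos (hm.pos _ _ _ _) (hm.pos _ _ _ _))

lemma measurable_slice₁ (hm : ChainGraphModel μ₁ μ₂ P A Y p) (a b : Fin 2) (z : ℝ) :
    Measurable fun y => p a b y z :=
  (hm.measurable_p a b).comp (measurable_id.prodMk measurable_const)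

lemma measurable_slice₂ (hm : ChainGraphModel μ₁ μ₂ P A Y p) (a b : Fin 2) (y : ℝ) :
    Measurable fun z => p a b y z :=
  (hm.measurable_p a b).comp (measurable_const.prodMk measurable_id)

lemma measurable_oddsRatio (hm : ChainGraphModel μ₁ μ₂ P A Y p) :
    Measurable (Function.uncurry (oddsRatio p)) :=
  ((hm.measurable_p 0 0).mul_const _).div
    (((hm.measurable_slice₁ 0 0 0).comp measurable_fst).mul
      ((hm.measurable_slice₂ 0 0 0).comp measurable_snd))

/-- The bridge from the causal model to estimation: consistency for `β_h` uses only this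
factorisation. -/
lemma exists_observedLaw [IsProbabilityMeasure P] [SFinite μ₁] [SFinite μ₂]
    (hm : ChainGraphModel μ₁ μ₂ P A Y p) :
    ∃ π, ObservedLaw μ₁ μ₂ (P.map (observe A Y)) (baseline₁ μ₁ p) (baseline₂ μ₂ p)
      (oddsRatio p) π := by
  choose C hC hp using fun a => hm.exists_density_eq a a
  -- The weight absorbs the normalising constant of `f₁ γ f₂`, so it is not the arm probability
  -- itself.
  refine ⟨fun a => P.real (A ⁻¹' {a}) * C a, ?_, ?_, hm.measurable_oddsRatio, hm.baseline₁_pos,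
    hm.baseline₂_pos, hm.oddsRatio_pos, ?_, ?_, ?_, ?_⟩
  · exact fun a => (hm.measurable_slice₁ a a 0).div_const _
  · exact fun a => (hm.measurable_slice₂ a a 0).div_const _
  · intro a
    simp only [baseline₁, condDens₁, integral_div]
    exact div_self (hm.slice₁_pos _ _ _).ne'
  · intro a
    simp only [baseline₂, condDens₂, integral_div]
    exact div_self (hm.slice₂_pos _ _ _).ne'
  · intro a
    exact mul_pos (ENNReal.toReal_pos (hm.arm_pos a).ne' (measure_ne_top _ _)) (hC a)
  · rw [hm.map_observe]
    refine Finset.sum_congr rfl fun a _ => ?_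
    rw [ENNReal.ofReal_mul measureReal_nonneg, ofReal_measureReal, mul_smul]
    congr 1
    have h : (fun y : ℝ × ℝ => ENNReal.ofReal (p a a y.1 y.2)) = ENNReal.ofReal (C a) •
        fun y : ℝ × ℝ => ENNReal.ofReal
          (baseline₁ μ₁ p a y.1 * oddsRatio p y.1 y.2 * baseline₂ μ₂ p a y.2) := by
      funext y
      rw [Pi.smul_apply, smul_eq_mul, ← ENNReal.ofReal_mul (hC a).le, hp a]
    rw [h, withDensity_smul' _ _ ENNReal.ofReal_ne_top, Measure.map_smul]

end ChainGraphModel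

namespace ObservedLaw

variable {Q : Measure Obs} {f₁ f₂ : Fin 2 → ℝ → ℝ} {γ : ℝ → ℝ → ℝ} {π : Fin 2 → ℝ}

lemma density_pos (hQ : ObservedLaw μ₁ μ₂ Q f₁ f₂ γ π) (a : Fin 2) (y : ℝ × ℝ) :
    0 < f₁ a y.1 * γ y.1 y.2 * f₂ a y.2 :=
  mul_pos (mul_pos (hQ.f₁_pos _ _) (hQ.γ_pos _ _)) (hQ.f₂_pos _ _)

lemma measurable_density (hQ : ObservedLaw μ₁ μ₂ Q f₁ f₂ γ π) (a : Fin 2) :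
    Measurable fun y : ℝ × ℝ => f₁ a y.1 * γ y.1 y.2 * f₂ a y.2 :=
  (((hQ.measurable_f₁ a).comp measurable_fst).mul hQ.measurable_γ).mul
    ((hQ.measurable_f₂ a).comp measurable_snd)

lemma ne_zero₁ (hQ : ObservedLaw μ₁ μ₂ Q f₁ f₂ γ π) : μ₁ ≠ 0 := by
  rintro rfl
  simpa using hQ.f₁_integral 0

lemma ne_zero₂ (hQ : ObservedLaw μ₁ μ₂ Q f₁ f₂ γ π) : μ₂ ≠ 0 := by
  rintro rfl
  simpa using hQ.f₂_integral 0

/-- A nonintegrable function has integral `0`, so total mass one already gives integrability. -/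
lemma integrable_f₁ (hQ : ObservedLaw μ₁ μ₂ Q f₁ f₂ γ π) (a : Fin 2) : Integrable (f₁ a) μ₁ :=
  Integrable.of_integral_ne_zero (by rw [hQ.f₁_integral]; exact one_ne_zero)

lemma integrable_f₂ (hQ : ObservedLaw μ₁ μ₂ Q f₁ f₂ γ π) (a : Fin 2) : Integrable (f₂ a) μ₂ :=
  Integrable.of_integral_ne_zero (by rw [hQ.f₂_integral]; exact one_ne_zero)

lemma lintegral_eq (hQ : ObservedLaw μ₁ μ₂ Q f₁ f₂ γ π) {F : Obs → ENNReal}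
    (hF : ∀ a, Measurable fun y => F (a, y)) :
    ∫⁻ x, F x ∂Q = ∑ a, ENNReal.ofReal (π a) * ∫⁻ y,
      ENNReal.ofReal (f₁ a y.1 * γ y.1 y.2 * f₂ a y.2) * F (a, y) ∂(μ₁.prod μ₂) := by
  rw [hQ.law, lintegral_finsetSum_measure]
  refine Finset.sum_congr rfl fun a _ => ?_
  rw [lintegral_smul_measure, (measurableEmbedding_prodMk_left a).lintegral_map,
    lintegral_withDensity_eq_lintegral_mul _ (hQ.measurable_density a).ennreal_ofReal (hF a)]
  rfl

/-- Weights and densities are positive, so the reference measure is absolutely continuous with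
respect to each arm of `Q`. -/
lemma ae_arm (hQ : ObservedLaw μ₁ μ₂ Q f₁ f₂ γ π) {C : Obs → Prop} (hC : ∀ᵐ x ∂Q, C x)
    (a : Fin 2) : ∀ᵐ y ∂(μ₁.prod μ₂), C (a, y) := by
  rw [hQ.law, ae_finsetSum_measure_iff] at hC
  have h := hC a (Finset.mem_univ a)
  rw [Measure.ae_ennreal_smul_measure_iff (ENNReal.ofReal_pos.2 (hQ.weight_pos a)).ne',
    (measurableEmbedding_prodMk_left a).ae_map_iff,
    ae_withDensity_iff (hQ.measurable_density a).ennreal_ofReal] at h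
  exact h.mono fun y hy => hy (ENNReal.ofReal_pos.2 (hQ.density_pos a y)).ne'

lemma integrable_arm (hQ : ObservedLaw μ₁ μ₂ Q f₁ f₂ γ π) {E : Type*} [NormedAddCommGroup E]
    [NormedSpace ℝ E] {F : Obs → E} (hF : Integrable F Q) (a : Fin 2) :
    Integrable (fun y : ℝ × ℝ => (f₁ a y.1 * γ y.1 y.2 * f₂ a y.2) • F (a, y))
      (μ₁.prod μ₂) := by
  rw [hQ.law, integrable_finsetSum_measure] at hF
  have h := hF a (Finset.mem_univ a)
  rw [integrable_smul_measure (ENNReal.ofReal_pos.2 (hQ.weight_pos a)).ne' ENNReal.ofReal_ne_top,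
    (measurableEmbedding_prodMk_left a).integrable_map_iff,
    integrable_withDensity_iff_integrable_smul' (hQ.measurable_density a).ennreal_ofReal
      (ae_of_all _ fun _ => ENNReal.ofReal_lt_top)] at h
  refine h.congr (ae_of_all _ fun y => ?_)
  simp only [ENNReal.toReal_ofReal (hQ.density_pos a y).le, Function.comp_apply]

lemma integral_eq (hQ : ObservedLaw μ₁ μ₂ Q f₁ f₂ γ π) {E : Type*} [NormedAddCommGroup E]
    [NormedSpace ℝ E] [CompleteSpace E] {F : Obs → E} (hF : Integrable F Q) :
    ∫ x, F x ∂Q = ∑ a, π a • ∫ y : ℝ × ℝ,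
      (f₁ a y.1 * γ y.1 y.2 * f₂ a y.2) • F (a, y) ∂(μ₁.prod μ₂) := by
  have h := hF
  rw [hQ.law, integrable_finsetSum_measure] at h
  rw [hQ.law, integral_finsetSum_measure h]
  refine Finset.sum_congr rfl fun a _ => ?_
  rw [integral_smul_measure, (measurableEmbedding_prodMk_left a).integral_map,
    integral_withDensity_eq_integral_toReal_smul (hQ.measurable_density a).ennreal_ofReal
      (ae_of_all _ fun _ => ENNReal.ofReal_lt_top), ENNReal.toReal_ofReal (hQ.weight_pos a).le]
  congr 1
  refine integral_congr_ae (ae_of_all _ fun y => ?_)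
  simp only [ENNReal.toReal_ofReal (hQ.density_pos a y).le]

end ObservedLaw

end ObservedLaw


/-! ### Gibbs' inequality for conditional densities -/

section Gibbs

/-- Gibbs' inequality for the ratio of two positive functions. -/
lemma integral_log_le_of_lintegral_ratio {X : Type*} [MeasurableSpace X] {Q : Measure X}
    [IsProbabilityMeasure Q] {u v : X → ℝ} (hu : ∀ x, 0 < u x) (hv : ∀ x, 0 < v x)
    (hlu : Integrable (fun x => Real.log (u x)) Q) (hlv : Integrable (fun x => Real.log (v x)) Q)
    (hm : AEMeasurable (fun x => u x / v x) Q)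
    (h1 : ∫⁻ x, ENNReal.ofReal (u x / v x) ∂Q = 1) :
    ∫ x, Real.log (u x) ∂Q ≤ ∫ x, Real.log (v x) ∂Q ∧
      (∫ x, Real.log (v x) ∂Q ≤ ∫ x, Real.log (u x) ∂Q → u =ᵐ[Q] v) := by
  have hr0 : ∀ x, 0 < u x / v x := fun x => div_pos (hu x) (hv x)
  have hri : Integrable (fun x => u x / v x) Q := by
    refine ⟨hm.aestronglyMeasurable, ?_⟩
    rw [hasFiniteIntegral_iff_ofReal (ae_of_all _ fun x => (hr0 x).le), h1]
    exact ENNReal.one_lt_top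
  have hr1 : ∫ x, u x / v x ∂Q = 1 := by
    rw [integral_eq_lintegral_of_nonneg_ae (ae_of_all _ fun x => (hr0 x).le)
      hm.aestronglyMeasurable, h1, ENNReal.toReal_one]
  -- With `r = u / v`, this is `r - 1 - log r`: nonnegative, zero only at `r = 1`, with integral
  -- equal to the log-likelihood gap because `r` has mean one.
  set g : X → ℝ := fun x => u x / v x - 1 - (Real.log (u x) - Real.log (v x)) with hg
  have hgi : Integrable g Q := (hri.sub (integrable_const 1)).sub (hlu.sub hlv)
  have hg0 : ∀ x, 0 ≤ g x := by
    intro x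
    have := Real.log_le_sub_one_of_pos (hr0 x)
    rw [Real.log_div (hu x).ne' (hv x).ne'] at this
    simp only [hg]
    linarith
  have hgI : ∫ x, g x ∂Q = ∫ x, Real.log (v x) ∂Q - ∫ x, Real.log (u x) ∂Q := by
    have e1 : ∫ x, g x ∂Q = ∫ x, (u x / v x - 1) ∂Q - ∫ x, (Real.log (u x) - Real.log (v x)) ∂Q :=
      integral_sub (hri.sub (integrable_const 1)) (hlu.sub hlv)
    rw [e1, integral_sub hri (integrable_const 1), integral_sub hlu hlv, hr1]
    simp
  refine ⟨?_, fun hle => ?_⟩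
  · have : 0 ≤ ∫ x, g x ∂Q := integral_nonneg hg0
    linarith
  · have h0 : ∫ x, g x ∂Q = 0 := le_antisymm (by linarith) (integral_nonneg hg0)
    rw [integral_eq_zero_iff_of_nonneg hg0 hgi] at h0
    filter_upwards [h0] with x hx
    by_contra hne
    have hne' : u x / v x ≠ 1 := fun h => hne ((div_eq_one_iff_eq (hv x).ne').1 h)
    have := Real.log_lt_sub_one_of_pos (hr0 x) hne'
    rw [Real.log_div (hu x).ne' (hv x).ne'] at this
    simp only [hg, Pi.zero_apply] at hx
    linarith

/-- The ratio of two conditional densities given the second coordinate integrates to one under the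
law with the conditional density in the denominator. -/
lemma lintegral_conditional_ratio {μ μ' : Measure ℝ} [SFinite μ] [SFinite μ'] (hμ : μ ≠ 0)
    {q q₀ : ℝ × ℝ → ℝ} {w : ℝ → ℝ} (hq : Measurable q) (hq₀ : Measurable q₀) (hw : Measurable w)
    (hqp : ∀ y, 0 < q y) (hq₀p : ∀ y, 0 < q₀ y) (hwp : ∀ z, 0 < w z)
    (hqi : ∀ z, Integrable (fun y => q (y, z)) μ) (hq₀i : ∀ z, Integrable (fun y => q₀ (y, z)) μ) :
    ∫⁻ y, ENNReal.ofReal (q₀ y * w y.2) * ENNReal.ofReal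
      ((q y / ∫ t, q (t, y.2) ∂μ) / (q₀ y / ∫ t, q₀ (t, y.2) ∂μ)) ∂(μ.prod μ') =
      ∫⁻ y, ENNReal.ofReal (q₀ y * w y.2) ∂(μ.prod μ') := by
  have hK : Measurable fun z => ∫ t, q (t, z) ∂μ :=
    (hq.stronglyMeasurable.integral_prod_left').measurable
  have hK₀ : Measurable fun z => ∫ t, q₀ (t, z) ∂μ :=
    (hq₀.stronglyMeasurable.integral_prod_left').measurable
  have hm₀ : Measurable fun y : ℝ × ℝ => ENNReal.ofReal (q₀ y * w y.2) :=
    (hq₀.mul (hw.comp measurable_snd)).ennreal_ofReal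
  have hm : Measurable fun y : ℝ × ℝ => ENNReal.ofReal (q₀ y * w y.2) * ENNReal.ofReal
      ((q y / ∫ t, q (t, y.2) ∂μ) / (q₀ y / ∫ t, q₀ (t, y.2) ∂μ)) :=
    hm₀.mul ((hq.div (hK.comp measurable_snd)).div
      (hq₀.div (hK₀.comp measurable_snd))).ennreal_ofReal
  rw [lintegral_prod_symm _ hm.aemeasurable, lintegral_prod_symm _ hm₀.aemeasurable]
  refine lintegral_congr fun z => ?_
  have hKz : 0 < ∫ t, q (t, z) ∂μ := integral_pos_of_pos hμ (fun _ => hqp _) (hqi z)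
  have hK₀z : 0 < ∫ t, q₀ (t, z) ∂μ := integral_pos_of_pos hμ (fun _ => hq₀p _) (hq₀i z)
  -- At fixed `z` the factor `q₀` cancels, leaving `q` times a constant; integrating over `y` also
  -- cancels the normaliser of `q`.
  have e1 : ∀ y, ENNReal.ofReal (q₀ (y, z) * w z) * ENNReal.ofReal
      ((q (y, z) / ∫ t, q (t, z) ∂μ) / (q₀ (y, z) / ∫ t, q₀ (t, z) ∂μ)) =
      ENNReal.ofReal (q (y, z) * (w z * (∫ t, q₀ (t, z) ∂μ) / ∫ t, q (t, z) ∂μ)) := by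
    intro y
    rw [← ENNReal.ofReal_mul (mul_pos (hq₀p _) (hwp _)).le]
    congr 1
    have := hq₀p (y, z)
    field_simp
  have hwz := hwp z
  simp only [e1]
  rw [← ofReal_integral_eq_lintegral_ofReal ((hqi z).mul_const _)
      (ae_of_all _ fun y => (mul_pos (hqp _) (by positivity)).le),
    ← ofReal_integral_eq_lintegral_ofReal ((hq₀i z).mul_const _)
      (ae_of_all _ fun y => (mul_pos (hq₀p _) hwz).le), integral_mul_const, integral_mul_const]
  congr 1
  field_simp

/-- Two probability densities whose ratio depends almost everywhere on another variable only are
equal. -/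
lemma ae_eq_of_ae_eq_mul {μ μ' : Measure ℝ} [SFinite μ] [SFinite μ'] (hμ' : μ' ≠ 0)
    {g g₀ c : ℝ → ℝ} (hg : ∫ y, g y ∂μ = 1) (hg₀ : ∫ y, g₀ y ∂μ = 1)
    (h : ∀ᵐ y ∂(μ.prod μ'), g y.1 = g₀ y.1 * c y.2) : g =ᵐ[μ] g₀ := by
  have h1 : ∀ᵐ z ∂(μ'.prod μ), g z.2 = g₀ z.2 * c z.1 :=
    Measure.measurePreserving_swap.quasiMeasurePreserving.ae h
  -- One slice at a good `z` suffices: there both densities integrate to one, which forces `c z =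
  -- 1`.
  have : NeBot (ae μ') := ae_neBot.2 hμ'
  obtain ⟨z, hz⟩ := (Measure.ae_ae_of_ae_prod h1).exists
  have hc : c z = 1 := by
    have e : ∫ y, g y ∂μ = ∫ y, g₀ y * c z ∂μ := integral_congr_ae hz
    rw [integral_mul_const, hg, hg₀, one_mul] at e
    exact e.symm
  filter_upwards [hz] with y hy
  rw [hy, hc, mul_one]

end Gibbs

/-! ### Basic properties of the parametric models -/

namespace ParametricModel

variable {μ₁ μ₂ : Measure ℝ} {Θ₁ Θ₂ N : Type*} (M : ParametricModel μ₁ μ₂ Θ₁ Θ₂ N)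

lemma integrable_f₁ (a : Fin 2) (ω₁ : Θ₁) : Integrable (fun y => M.f₁ a y ω₁) μ₁ :=
  Integrable.of_integral_ne_zero (by rw [M.f₁_integral]; exact one_ne_zero)

lemma integrable_f₂ (a : Fin 2) (ω₂ : Θ₂) : Integrable (fun y => M.f₂ a y ω₂) μ₂ :=
  Integrable.of_integral_ne_zero (by rw [M.f₂_integral]; exact one_ne_zero)

lemma integral_centred₁ (a : Fin 2) (ω₁ : Θ₁) :
    ∫ y, M.f₁ a y ω₁ * (y - M.mean₁ a ω₁) ∂μ₁ = 0 := by
  have h : ∀ y, M.f₁ a y ω₁ * (y - M.mean₁ a ω₁) =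
    y * M.f₁ a y ω₁ - M.f₁ a y ω₁ * M.mean₁ a ω₁ := fun y => by ring
  simp only [h]
  rw [integral_sub (M.f₁_moment a ω₁) ((M.integrable_f₁ a ω₁).mul_const _), integral_mul_const,
    M.f₁_integral, one_mul, mean₁, sub_self]

lemma integral_centred₂ (a : Fin 2) (ω₂ : Θ₂) :
    ∫ y, M.f₂ a y ω₂ * (y - M.mean₂ a ω₂) ∂μ₂ = 0 := by
  have h : ∀ y, M.f₂ a y ω₂ * (y - M.mean₂ a ω₂) =
    y * M.f₂ a y ω₂ - M.f₂ a y ω₂ * M.mean₂ a ω₂ := fun y => by ring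
  simp only [h]
  rw [integral_sub (M.f₂_moment a ω₂) ((M.integrable_f₂ a ω₂).mul_const _), integral_mul_const,
    M.f₂_integral, one_mul, mean₂, sub_self]

lemma normaliser₁_pos (hμ₁ : μ₁ ≠ 0) (a : Fin 2) (y₂ : ℝ) (ω₁ : Θ₁) (ν : N) :
    0 < ∫ y, M.f₁ a y ω₁ * M.γ y y₂ ν ∂μ₁ :=
  integral_pos_of_pos hμ₁ (fun _ => mul_pos (M.f₁_pos _ _ _) (M.γ_pos _ _ _)) (M.norm₁ _ _ _ _)

lemma normaliser₂_pos (hμ₂ : μ₂ ≠ 0) (a : Fin 2) (y₁ : ℝ) (ω₂ : Θ₂) (ν : N) :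
    0 < ∫ y, M.f₂ a y ω₂ * M.γ y₁ y ν ∂μ₂ :=
  integral_pos_of_pos hμ₂ (fun _ => mul_pos (M.f₂_pos _ _ _) (M.γ_pos _ _ _)) (M.norm₂ _ _ _ _)

lemma cond₁_pos (hμ₁ : μ₁ ≠ 0) (x : Obs) (ω₁ : Θ₁) (ν : N) : 0 < M.cond₁ x ω₁ ν :=
  div_pos (mul_pos (M.f₁_pos _ _ _) (M.γ_pos _ _ _)) (M.normaliser₁_pos hμ₁ _ _ _ _)

lemma cond₂_pos (hμ₂ : μ₂ ≠ 0) (x : Obs) (ω₂ : Θ₂) (ν : N) : 0 < M.cond₂ x ω₂ ν :=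
  div_pos (mul_pos (M.f₂_pos _ _ _) (M.γ_pos _ _ _)) (M.normaliser₂_pos hμ₂ _ _ _ _)

lemma measurable_joint₁ (a : Fin 2) (ω₁ : Θ₁) (ν : N) :
    Measurable fun y : ℝ × ℝ => M.f₁ a y.1 ω₁ * M.γ y.1 y.2 ν :=
  ((M.measurable_f₁ a ω₁).comp measurable_fst).mul (M.measurable_γ ν)

lemma measurable_joint₂ (a : Fin 2) (ω₂ : Θ₂) (ν : N) :
    Measurable fun z : ℝ × ℝ => M.f₂ a z.1 ω₂ * M.γ z.2 z.1 ν :=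
  ((M.measurable_f₂ a ω₂).comp measurable_fst).mul ((M.measurable_γ ν).comp measurable_swap)

lemma measurable_cond₁ [SFinite μ₁] (ω₁ : Θ₁) (ν : N) :
    Measurable fun x => M.cond₁ x ω₁ ν := by
  refine measurable_from_prod_countable_right fun a => ?_
  have hK : Measurable fun z => ∫ t, M.f₁ a t ω₁ * M.γ t z ν ∂μ₁ :=
    (M.measurable_joint₁ a ω₁ ν).stronglyMeasurable.integral_prod_left'.measurable
  exact (M.measurable_joint₁ a ω₁ ν).div (hK.comp measurable_snd)

lemma measurable_cond₂ [SFinite μ₂] (ω₂ : Θ₂) (ν : N) :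
    Measurable fun x => M.cond₂ x ω₂ ν := by
  refine measurable_from_prod_countable_right fun a => ?_
  have hK : Measurable fun z => ∫ t, M.f₂ a t ω₂ * M.γ z t ν ∂μ₂ :=
    (M.measurable_joint₂ a ω₂ ν).stronglyMeasurable.integral_prod_left'.measurable
  exact ((M.measurable_joint₂ a ω₂ ν).comp measurable_swap).div (hK.comp measurable_fst)

/-- Needed for a possibly wrong baseline: `PopRoot` asks for a maximiser in both models, and
compactness supplies one. -/
lemma exists_popMax₁ [MetricSpace Θ₁] [CompactSpace Θ₁] [Nonempty Θ₁] [MetricSpace Θ₂]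
    [MetricSpace N] {k : ℕ} {η : Fin 2 → EuclideanSpace ℝ (Fin k)} {Q : Measure Obs}
    (hreg : M.NuisanceRegular η Q) (ν : N) :
    ∃ ω, M.PopMax₁ Q ν ω := by
  have hc : Continuous fun ω => ∫ x, Real.log (M.cond₁ x ω ν) ∂Q :=
    hreg.loglik₁.continuous_integral.comp (Continuous.prodMk_left ν)
  obtain ⟨ω, -, h⟩ := isCompact_univ.exists_isMaxOn Set.univ_nonempty hc.continuousOn
  exact ⟨ω, fun ω' => h (Set.mem_univ ω')⟩

lemma exists_popMax₂ [MetricSpace Θ₁] [MetricSpace Θ₂] [CompactSpace Θ₂] [Nonempty Θ₂]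
    [MetricSpace N] {k : ℕ} {η : Fin 2 → EuclideanSpace ℝ (Fin k)} {Q : Measure Obs}
    (hreg : M.NuisanceRegular η Q) (ν : N) :
    ∃ ω, M.PopMax₂ Q ν ω := by
  have hc : Continuous fun ω => ∫ x, Real.log (M.cond₂ x ω ν) ∂Q :=
    hreg.loglik₂.continuous_integral.comp (Continuous.prodMk_left ν)
  obtain ⟨ω, -, h⟩ := isCompact_univ.exists_isMaxOn Set.univ_nonempty hc.continuousOn
  exact ⟨ω, fun ω' => h (Set.mem_univ ω')⟩

end ParametricModel

/-! ### Conditional likelihoods and the score at the true odds ratio -/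

namespace ObservedLaw

variable {μ₁ μ₂ : Measure ℝ} [SFinite μ₁] [SFinite μ₂] {Q : Measure Obs} [IsProbabilityMeasure Q]
  {f₁ f₂ : Fin 2 → ℝ → ℝ} {γ : ℝ → ℝ → ℝ} {π : Fin 2 → ℝ}
  {Θ₁ Θ₂ N : Type*} {M : ParametricModel μ₁ μ₂ Θ₁ Θ₂ N} {ν₀ : N}

/-- Only `γ` and `f₁` have to be correct: `f₂` depends on the conditioning variable alone and enters
as the weight `w`. -/
lemma lintegral_cond_ratio₁ (hQ : ObservedLaw μ₁ μ₂ Q f₁ f₂ γ π)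
    (hγ : ∀ y₁ y₂, M.γ y₁ y₂ ν₀ = γ y₁ y₂) {ω₀ : Θ₁} (hf : ∀ a y, M.f₁ a y ω₀ = f₁ a y)
    (ω : Θ₁) : ∫⁻ x, ENNReal.ofReal (M.cond₁ x ω ν₀ / M.cond₁ x ω₀ ν₀) ∂Q = 1 := by
  have hm : ∀ a, Measurable fun y : ℝ × ℝ =>
      ENNReal.ofReal (M.cond₁ (a, y) ω ν₀ / M.cond₁ (a, y) ω₀ ν₀) := fun a =>
    (((M.measurable_cond₁ ω ν₀).div (M.measurable_cond₁ ω₀ ν₀)).comp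
      measurable_prodMk_left).ennreal_ofReal
  have h1 : ∫⁻ _, 1 ∂Q = 1 := by simp
  rw [hQ.lintegral_eq hm, ← h1, hQ.lintegral_eq fun a => measurable_const]
  refine Finset.sum_congr rfl fun a _ => ?_
  congr 1
  have h := lintegral_conditional_ratio (μ' := μ₂) (w := f₂ a) hQ.ne_zero₁
    (M.measurable_joint₁ a ω ν₀) (M.measurable_joint₁ a ω₀ ν₀) (hQ.measurable_f₂ a)
    (fun _ => mul_pos (M.f₁_pos _ _ _) (M.γ_pos _ _ _))
    (fun _ => mul_pos (M.f₁_pos _ _ _) (M.γ_pos _ _ _)) (hQ.f₂_pos a)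
    (fun z => M.norm₁ a z ω ν₀) (fun z => M.norm₁ a z ω₀ ν₀)
  simp only [ParametricModel.cond₁, mul_one, ← hf, ← hγ] at h ⊢
  exact h

lemma lintegral_cond_ratio₂ (hQ : ObservedLaw μ₁ μ₂ Q f₁ f₂ γ π)
    (hγ : ∀ y₁ y₂, M.γ y₁ y₂ ν₀ = γ y₁ y₂) {ω₀ : Θ₂} (hf : ∀ a y, M.f₂ a y ω₀ = f₂ a y)
    (ω : Θ₂) : ∫⁻ x, ENNReal.ofReal (M.cond₂ x ω ν₀ / M.cond₂ x ω₀ ν₀) ∂Q = 1 := by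
  have hm : ∀ a, Measurable fun y : ℝ × ℝ =>
      ENNReal.ofReal (M.cond₂ (a, y) ω ν₀ / M.cond₂ (a, y) ω₀ ν₀) := fun a =>
    (((M.measurable_cond₂ ω ν₀).div (M.measurable_cond₂ ω₀ ν₀)).comp
      measurable_prodMk_left).ennreal_ofReal
  have h1 : ∫⁻ _, 1 ∂Q = 1 := by simp
  rw [hQ.lintegral_eq hm, ← h1, hQ.lintegral_eq fun a => measurable_const]
  refine Finset.sum_congr rfl fun a _ => ?_
  congr 1
  have h := lintegral_conditional_ratio (μ' := μ₁) (w := f₁ a) hQ.ne_zero₂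
    (M.measurable_joint₂ a ω ν₀) (M.measurable_joint₂ a ω₀ ν₀) (hQ.measurable_f₁ a)
    (fun _ => mul_pos (M.f₂_pos _ _ _) (M.γ_pos _ _ _))
    (fun _ => mul_pos (M.f₂_pos _ _ _) (M.γ_pos _ _ _)) (hQ.f₁_pos a)
    (fun z => M.norm₂ a z ω ν₀) (fun z => M.norm₂ a z ω₀ ν₀)
  -- The general lemma conditions on the second coordinate, so the outcomes are exchanged.
  rw [← lintegral_prod_swap (μ := μ₁) (ν := μ₂), ← lintegral_prod_swap (μ := μ₁) (ν := μ₂)]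
  simp only [ParametricModel.cond₂, mul_one, ← hf, ← hγ, Prod.fst_swap, Prod.snd_swap] at h ⊢
  simp only [mul_comm, mul_left_comm] at h ⊢
  exact h

section Regular

variable [MetricSpace Θ₁] [MetricSpace Θ₂] [MetricSpace N]
  {k : ℕ} {η : Fin 2 → EuclideanSpace ℝ (Fin k)}

lemma popMax₁ (hQ : ObservedLaw μ₁ μ₂ Q f₁ f₂ γ π) (hreg : M.NuisanceRegular η Q)
    (hγ : ∀ y₁ y₂, M.γ y₁ y₂ ν₀ = γ y₁ y₂) {ω₀ : Θ₁} (hf : ∀ a y, M.f₁ a y ω₀ = f₁ a y) :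
    M.PopMax₁ Q ν₀ ω₀ := fun ω =>
  (integral_log_le_of_lintegral_ratio (fun x => M.cond₁_pos hQ.ne_zero₁ x ω ν₀)
    (fun x => M.cond₁_pos hQ.ne_zero₁ x ω₀ ν₀) (hreg.loglik₁.integrable (ω, ν₀))
    (hreg.loglik₁.integrable (ω₀, ν₀))
    ((M.measurable_cond₁ ω ν₀).div (M.measurable_cond₁ ω₀ ν₀)).aemeasurable
    (hQ.lintegral_cond_ratio₁ hγ hf ω)).1

lemma popMax₂ (hQ : ObservedLaw μ₁ μ₂ Q f₁ f₂ γ π) (hreg : M.NuisanceRegular η Q)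
    (hγ : ∀ y₁ y₂, M.γ y₁ y₂ ν₀ = γ y₁ y₂) {ω₀ : Θ₂} (hf : ∀ a y, M.f₂ a y ω₀ = f₂ a y) :
    M.PopMax₂ Q ν₀ ω₀ := fun ω =>
  (integral_log_le_of_lintegral_ratio (fun x => M.cond₂_pos hQ.ne_zero₂ x ω ν₀)
    (fun x => M.cond₂_pos hQ.ne_zero₂ x ω₀ ν₀) (hreg.loglik₂.integrable (ω, ν₀))
    (hreg.loglik₂.integrable (ω₀, ν₀))
    ((M.measurable_cond₂ ω ν₀).div (M.measurable_cond₂ ω₀ ν₀)).aemeasurable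
    (hQ.lintegral_cond_ratio₂ hγ hf ω)).1

/-- Every maximiser of the population conditional log-likelihood gives the true baseline density,
if the model for it is correct. -/
lemma ae_eq_of_popMax₁ (hQ : ObservedLaw μ₁ μ₂ Q f₁ f₂ γ π) (hreg : M.NuisanceRegular η Q)
    (hγ : ∀ y₁ y₂, M.γ y₁ y₂ ν₀ = γ y₁ y₂) {ω₀ ω : Θ₁} (hf : ∀ a y, M.f₁ a y ω₀ = f₁ a y)
    (hω : M.PopMax₁ Q ν₀ ω) (a : Fin 2) : (fun y => M.f₁ a y ω) =ᵐ[μ₁] f₁ a := by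
  have h := (integral_log_le_of_lintegral_ratio (fun x => M.cond₁_pos hQ.ne_zero₁ x ω ν₀)
    (fun x => M.cond₁_pos hQ.ne_zero₁ x ω₀ ν₀) (hreg.loglik₁.integrable (ω, ν₀))
    (hreg.loglik₁.integrable (ω₀, ν₀))
    ((M.measurable_cond₁ ω ν₀).div (M.measurable_cond₁ ω₀ ν₀)).aemeasurable
    (hQ.lintegral_cond_ratio₁ hγ hf ω)).2 (hω ω₀)
  -- Equal conditional densities have `γ` in common; without it the baselines are proportional, and
  -- the factor is a ratio of normalisers depending on `y₂` only.
  refine ae_eq_of_ae_eq_mul hQ.ne_zero₂ (c := fun z => (∫ y, M.f₁ a y ω * M.γ y z ν₀ ∂μ₁) /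
    ∫ y, M.f₁ a y ω₀ * M.γ y z ν₀ ∂μ₁) (M.f₁_integral a ω) (hQ.f₁_integral a) ?_
  filter_upwards [hQ.ae_arm h a] with y hy
  have h1 := M.normaliser₁_pos hQ.ne_zero₁ a y.2 ω ν₀
  have h2 := M.normaliser₁_pos hQ.ne_zero₁ a y.2 ω₀ ν₀
  have h3 := M.γ_pos y.1 y.2 ν₀
  simp only [ParametricModel.cond₁] at hy
  rw [div_eq_div_iff h1.ne' h2.ne'] at hy
  rw [← hf, mul_div_assoc', eq_div_iff h2.ne']
  refine mul_right_cancel₀ h3.ne' ?_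
  linear_combination hy

lemma ae_eq_of_popMax₂ (hQ : ObservedLaw μ₁ μ₂ Q f₁ f₂ γ π) (hreg : M.NuisanceRegular η Q)
    (hγ : ∀ y₁ y₂, M.γ y₁ y₂ ν₀ = γ y₁ y₂) {ω₀ ω : Θ₂} (hf : ∀ a y, M.f₂ a y ω₀ = f₂ a y)
    (hω : M.PopMax₂ Q ν₀ ω) (a : Fin 2) : (fun y => M.f₂ a y ω) =ᵐ[μ₂] f₂ a := by
  have h := (integral_log_le_of_lintegral_ratio (fun x => M.cond₂_pos hQ.ne_zero₂ x ω ν₀)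
    (fun x => M.cond₂_pos hQ.ne_zero₂ x ω₀ ν₀) (hreg.loglik₂.integrable (ω, ν₀))
    (hreg.loglik₂.integrable (ω₀, ν₀))
    ((M.measurable_cond₂ ω ν₀).div (M.measurable_cond₂ ω₀ ν₀)).aemeasurable
    (hQ.lintegral_cond_ratio₂ hγ hf ω)).2 (hω ω₀)
  refine ae_eq_of_ae_eq_mul hQ.ne_zero₁ (c := fun z => (∫ y, M.f₂ a y ω * M.γ z y ν₀ ∂μ₂) /
    ∫ y, M.f₂ a y ω₀ * M.γ z y ν₀ ∂μ₂) (M.f₂_integral a ω) (hQ.f₂_integral a) ?_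
  refine (Measure.measurePreserving_swap (μ := μ₂) (ν := μ₁)).quasiMeasurePreserving.ae
    (p := fun y : ℝ × ℝ => M.f₂ a y.2 ω = f₂ a y.2 * ((∫ t, M.f₂ a t ω * M.γ y.1 t ν₀ ∂μ₂) /
      ∫ t, M.f₂ a t ω₀ * M.γ y.1 t ν₀ ∂μ₂)) ?_
  filter_upwards [hQ.ae_arm h a] with y hy
  have h1 := M.normaliser₂_pos hQ.ne_zero₂ a y.1 ω ν₀
  have h2 := M.normaliser₂_pos hQ.ne_zero₂ a y.1 ω₀ ν₀
  have h3 := M.γ_pos y.1 y.2 ν₀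
  simp only [ParametricModel.cond₂] at hy
  rw [div_eq_div_iff h1.ne' h2.ne'] at hy
  rw [← hf, mul_div_assoc', eq_div_iff h2.ne']
  refine mul_right_cancel₀ h3.ne' ?_
  linear_combination hy

omit [IsProbabilityMeasure Q] in
/-- The estimating function for `ν` is unbiased at the true odds ratio if one of the baseline means
is centred correctly. -/
lemma integral_nuScore (hQ : ObservedLaw μ₁ μ₂ Q f₁ f₂ γ π) (hreg : M.NuisanceRegular η Q)
    (hγ : ∀ y₁ y₂, M.γ y₁ y₂ ν₀ = γ y₁ y₂) {ω₁ : Θ₁} {ω₂ : Θ₂}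
    (hf : (∀ a y, M.f₁ a y ω₁ = f₁ a y) ∨ ∀ a y, M.f₂ a y ω₂ = f₂ a y) :
    ∫ x, M.nuScore η x ω₁ ω₂ ν₀ ∂Q = 0 := by
  rw [hQ.integral_eq (hreg.score.integrable (ω₁, ω₂, ν₀))]
  refine Finset.sum_eq_zero fun a _ => ?_
  -- The inverse odds ratio in the score cancels `γ` in the density and separates the variables.
  have h : ∀ y : ℝ × ℝ, (f₁ a y.1 * γ y.1 y.2 * f₂ a y.2) • M.nuScore η (a, y) ω₁ ω₂ ν₀ =
      ((f₁ a y.1 * (y.1 - M.mean₁ a ω₁)) * (f₂ a y.2 * (y.2 - M.mean₂ a ω₂))) • η a := by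
    intro y
    rw [ParametricModel.nuScore, smul_smul, hγ]
    congr 1
    have := hQ.γ_pos y.1 y.2
    field_simp
  simp only [h]
  rw [integral_smul_const, integral_prod_mul (fun y => f₁ a y * (y - M.mean₁ a ω₁))
    (fun y => f₂ a y * (y - M.mean₂ a ω₂))]
  rcases hf with hf | hf
  · simp only [← hf, M.integral_centred₁, zero_mul, zero_smul, smul_zero]
  · simp only [← hf, M.integral_centred₂, mul_zero, zero_smul, smul_zero]

/-- The correct model contributes its true parameter, the other one any maximiser: one centred
factor is enough. -/
lemma popRoot [CompactSpace Θ₁] [Nonempty Θ₁] [CompactSpace Θ₂] [Nonempty Θ₂]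
    (hQ : ObservedLaw μ₁ μ₂ Q f₁ f₂ γ π) (hreg : M.NuisanceRegular η Q)
    (hγ : ∀ y₁ y₂, M.γ y₁ y₂ ν₀ = γ y₁ y₂)
    (hf : (∃ ω₁, ∀ a y, M.f₁ a y ω₁ = f₁ a y) ∨ ∃ ω₂, ∀ a y, M.f₂ a y ω₂ = f₂ a y) :
    M.PopRoot η Q ν₀ := by
  rcases hf with ⟨ω₁, hf⟩ | ⟨ω₂, hf⟩
  · obtain ⟨ω₂, h₂⟩ := M.exists_popMax₂ hreg ν₀
    exact ⟨ω₁, ω₂, hQ.popMax₁ hreg hγ hf, h₂, hQ.integral_nuScore hreg hγ (Or.inl hf)⟩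
  · obtain ⟨ω₁, h₁⟩ := M.exists_popMax₁ hreg ν₀
    exact ⟨ω₁, ω₂, h₁, hQ.popMax₂ hreg hγ hf, hQ.integral_nuScore hreg hγ (Or.inr hf)⟩

end Regular

end ObservedLaw


/-! ### Population estimating equations for `β_h` -/

section Product

variable {μ μ' : Measure ℝ} {F G : ℝ → ℝ}

/-- Almost every section is integrable; one of them is divided by its positive constant. This
extracts one-variable integrability from that of the estimating functions. -/
lemma integrable_fst_of_prod_mul [SFinite μ] [SFinite μ'] (hμ' : μ' ≠ 0) (hG : ∀ z, 0 < G z)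
    (h : Integrable (fun y : ℝ × ℝ => F y.1 * G y.2) (μ.prod μ')) : Integrable F μ := by
  have : NeBot (ae μ') := ae_neBot.2 hμ'
  obtain ⟨z, hz⟩ := h.prod_left_ae.exists
  refine (hz.mul_const (G z)⁻¹).congr (ae_of_all _ fun y => ?_)
  have := hG z
  field_simp

lemma integrable_snd_of_prod_mul [SFinite μ] [SFinite μ'] (hμ : μ ≠ 0) (hF : ∀ y, 0 < F y)
    (h : Integrable (fun y : ℝ × ℝ => F y.1 * G y.2) (μ.prod μ')) : Integrable G μ' := by
  have : NeBot (ae μ) := ae_neBot.2 hμ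
  obtain ⟨y, hy⟩ := h.prod_right_ae.exists
  refine (hy.const_mul (F y)⁻¹).congr (ae_of_all _ fun z => ?_)
  have := hF y
  field_simp

lemma integral_sub_sub {f g k : ℝ → ℝ} (hf : Integrable f μ) (hg : Integrable g μ)
    (hk : Integrable k μ) :
    ∫ y, (f y - g y - k y) ∂μ = ∫ y, f y ∂μ - ∫ y, g y ∂μ - ∫ y, k y ∂μ := by
  rw [← integral_sub hf hg]
  exact integral_sub (hf.sub hg) hk

end Product

namespace ObservedLaw

variable {μ₁ μ₂ : Measure ℝ} {Q : Measure Obs}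
  {f₁ f₂ : Fin 2 → ℝ → ℝ} {γ : ℝ → ℝ → ℝ} {π : Fin 2 → ℝ}

/-- The integral of a function that vanishes off one arm. -/
lemma integral_eq_arm (hQ : ObservedLaw μ₁ μ₂ Q f₁ f₂ γ π) {F : Obs → ℝ} (hF : Integrable F Q)
    (a : Fin 2) (h0 : ∀ b, b ≠ a → ∀ y, F (b, y) = 0) {G : ℝ × ℝ → ℝ}
    (hG : ∀ y : ℝ × ℝ, f₁ a y.1 * γ y.1 y.2 * f₂ a y.2 * F (a, y) = G y) :
    Integrable G (μ₁.prod μ₂) ∧ ∫ x, F x ∂Q = π a * ∫ y, G y ∂(μ₁.prod μ₂) := by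
  refine ⟨(hQ.integrable_arm hF a).congr (ae_of_all _ hG), ?_⟩
  rw [hQ.integral_eq hF, Finset.sum_eq_single a]
  · simp only [smul_eq_mul, hG]
  · intro b _ hb
    simp [h0 b hb]
  · simp

variable [SFinite μ₁] [SFinite μ₂]
  {Θ₁ Θ₂ N : Type*} [MetricSpace Θ₁] [MetricSpace Θ₂] [MetricSpace N]
  {M : ParametricModel μ₁ μ₂ Θ₁ Θ₂ N} {ν₀ : N} {h : ℝ → ℝ → ℝ} {a' a'' : Fin 2}

/-- After `γ` cancels, `y₁` integrates out. The function is affine in `b`, so its values at `0` and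
`1` give intercept and slope. -/
lemma integral_U₁ (hQ : ObservedLaw μ₁ μ₂ Q f₁ f₂ γ π) (hreg : M.BetaRegular h a' a'' Q)
    (hγ : ∀ y₁ y₂, M.γ y₁ y₂ ν₀ = γ y₁ y₂) (ω₁ : Θ₁) :
    Integrable (fun z => f₂ a'' z * M.inner₁ h a' z ω₁ ν₀) μ₂ ∧
    ∫ x, M.U₁ h a' a'' 0 x ω₁ ν₀ ∂Q = π a'' * ∫ z, f₂ a'' z * M.inner₁ h a' z ω₁ ν₀ ∂μ₂ ∧
    ∫ x, M.U₁ h a' a'' 0 x ω₁ ν₀ ∂Q - ∫ x, M.U₁ h a' a'' 1 x ω₁ ν₀ ∂Q = π a'' := by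
  have i0 := (hreg.reg₁ 0).integrable (ω₁, ν₀)
  have i1 := (hreg.reg₁ 1).integrable (ω₁, ν₀)
  obtain ⟨j0, e0⟩ := hQ.integral_eq_arm i0 a''
    (G := fun y => f₁ a'' y.1 * (f₂ a'' y.2 * M.inner₁ h a' y.2 ω₁ ν₀))
    (fun b hb y => by simp [ParametricModel.U₁, hb]) (fun y => by
      have := hQ.γ_pos y.1 y.2
      simp only [ParametricModel.U₁, hγ, if_true, sub_zero]
      field_simp)
  obtain ⟨-, e1⟩ := hQ.integral_eq_arm (i0.sub i1) a''
    (G := fun y => f₁ a'' y.1 * f₂ a'' y.2)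
    (fun b hb y => by simp [ParametricModel.U₁, hb]) (fun y => by
      have := hQ.γ_pos y.1 y.2
      simp only [ParametricModel.U₁, hγ, if_true, sub_zero, Pi.sub_apply]
      field_simp
      ring)
  refine ⟨integrable_snd_of_prod_mul hQ.ne_zero₁ (hQ.f₁_pos a'') j0, ?_, ?_⟩
  · rw [e0, integral_prod_mul (f₁ a'') fun z => f₂ a'' z * M.inner₁ h a' z ω₁ ν₀,
      hQ.f₁_integral, one_mul]
  · rw [← integral_sub i0 i1]
    refine e1.trans ?_
    rw [integral_prod_mul (f₁ a'') (f₂ a''), hQ.f₁_integral, hQ.f₂_integral, mul_one, mul_one]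

lemma integral_U₂ (hQ : ObservedLaw μ₁ μ₂ Q f₁ f₂ γ π) (hreg : M.BetaRegular h a' a'' Q)
    (hγ : ∀ y₁ y₂, M.γ y₁ y₂ ν₀ = γ y₁ y₂) (ω₂ : Θ₂) :
    Integrable (fun y => f₁ a' y * M.inner₂ h a'' y ω₂ ν₀) μ₁ ∧
    ∫ x, M.U₂ h a' a'' 0 x ω₂ ν₀ ∂Q = π a' * ∫ y, f₁ a' y * M.inner₂ h a'' y ω₂ ν₀ ∂μ₁ ∧
    ∫ x, M.U₂ h a' a'' 0 x ω₂ ν₀ ∂Q - ∫ x, M.U₂ h a' a'' 1 x ω₂ ν₀ ∂Q = π a' := by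
  have i0 := (hreg.reg₂ 0).integrable (ω₂, ν₀)
  have i1 := (hreg.reg₂ 1).integrable (ω₂, ν₀)
  obtain ⟨j0, e0⟩ := hQ.integral_eq_arm i0 a'
    (G := fun y => (f₁ a' y.1 * M.inner₂ h a'' y.1 ω₂ ν₀) * f₂ a' y.2)
    (fun b hb y => by simp [ParametricModel.U₂, hb]) (fun y => by
      have := hQ.γ_pos y.1 y.2
      simp only [ParametricModel.U₂, hγ, if_true, sub_zero]
      field_simp)
  obtain ⟨-, e1⟩ := hQ.integral_eq_arm (i0.sub i1) a'
    (G := fun y => f₁ a' y.1 * f₂ a' y.2)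
    (fun b hb y => by simp [ParametricModel.U₂, hb]) (fun y => by
      have := hQ.γ_pos y.1 y.2
      simp only [ParametricModel.U₂, hγ, if_true, sub_zero, Pi.sub_apply]
      field_simp
      ring)
  refine ⟨integrable_fst_of_prod_mul hQ.ne_zero₂ (hQ.f₂_pos a') j0, ?_, ?_⟩
  · rw [e0, integral_prod_mul (fun y => f₁ a' y * M.inner₂ h a'' y ω₂ ν₀) (f₂ a'),
      hQ.f₂_integral, mul_one]
  · rw [← integral_sub i0 i1]
    refine e1.trans ?_
    rw [integral_prod_mul (f₁ a') (f₂ a'), hQ.f₁_integral, hQ.f₂_integral, mul_one, mul_one]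

/-- The weight on the second outcome in the doubly robust estimating function, times the true
baseline density. -/
def reweighted (f₂ : Fin 2 → ℝ → ℝ) (M : ParametricModel μ₁ μ₂ Θ₁ Θ₂ N) (a' a'' : Fin 2)
    (ω₂ : Θ₂) (z : ℝ) : ℝ :=
  f₂ a' z * (M.f₂ a'' z ω₂ / M.f₂ a' z ω₂)

omit [SFinite μ₁] [SFinite μ₂] in
lemma integral_Udr_zero (hQ : ObservedLaw μ₁ μ₂ Q f₁ f₂ γ π) (hreg : M.BetaRegular h a' a'' Q)
    (hγ : ∀ y₁ y₂, M.γ y₁ y₂ ν₀ = γ y₁ y₂) (ω₁ : Θ₁) (ω₂ : Θ₂) {G : ℝ × ℝ → ℝ}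
    (hG : ∀ y : ℝ × ℝ, f₁ a' y.1 * reweighted f₂ M a' a'' ω₂ y.2 *
      (h y.1 y.2 * γ y.1 y.2 - M.inner₁ h a' y.2 ω₁ ν₀ - M.inner₂ h a'' y.1 ω₂ ν₀) = G y) :
    Integrable G (μ₁.prod μ₂) ∧
    ∫ x, M.Udr h a' a'' 0 0 0 x ω₁ ω₂ ν₀ ∂Q = π a' * ∫ y, G y ∂(μ₁.prod μ₂) := by
  refine hQ.integral_eq_arm ((hreg.reg_dr 0 0 0).integrable (ω₁, ω₂, ν₀)) a'
    (fun b hb y => by simp [ParametricModel.Udr, hb]) (fun y => ?_)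
  have h1 := hQ.γ_pos y.1 y.2
  have h2 := M.f₂_pos a' y.2 ω₂
  rw [← hG]
  simp only [ParametricModel.Udr, hγ, if_true, sub_zero, add_zero, reweighted]
  field_simp

lemma integral_Udr_sub (hQ : ObservedLaw μ₁ μ₂ Q f₁ f₂ γ π) (hreg : M.BetaRegular h a' a'' Q)
    (hγ : ∀ y₁ y₂, M.γ y₁ y₂ ν₀ = γ y₁ y₂) (ω₁ : Θ₁) (ω₂ : Θ₂) :
    0 < ∫ z, reweighted f₂ M a' a'' ω₂ z ∂μ₂ ∧
    ∫ x, M.Udr h a' a'' 0 0 0 x ω₁ ω₂ ν₀ ∂Q - ∫ x, M.Udr h a' a'' 1 0 0 x ω₁ ω₂ ν₀ ∂Q =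
      π a' * ∫ z, reweighted f₂ M a' a'' ω₂ z ∂μ₂ := by
  have i0 := (hreg.reg_dr 0 0 0).integrable (ω₁, ω₂, ν₀)
  have i1 := (hreg.reg_dr 1 0 0).integrable (ω₁, ω₂, ν₀)
  obtain ⟨j, e⟩ := hQ.integral_eq_arm (i0.sub i1) a'
    (G := fun y => f₁ a' y.1 * reweighted f₂ M a' a'' ω₂ y.2)
    (fun b hb y => by simp [ParametricModel.Udr, hb]) (fun y => by
      have h1 := hQ.γ_pos y.1 y.2
      have h2 := M.f₂_pos a' y.2 ω₂
      simp only [ParametricModel.Udr, hγ, if_true, sub_zero, add_zero, Pi.sub_apply, reweighted]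
      field_simp
      ring)
  refine ⟨integral_pos_of_pos hQ.ne_zero₂ (fun z => mul_pos (hQ.f₂_pos _ _)
    (div_pos (M.f₂_pos _ _ _) (M.f₂_pos _ _ _)))
    (integrable_snd_of_prod_mul hQ.ne_zero₁ (hQ.f₁_pos a') j), ?_⟩
  rw [← integral_sub i0 i1]
  refine e.trans ?_
  rw [integral_prod_mul (f₁ a') (reweighted f₂ M a' a'' ω₂), hQ.f₁_integral, one_mul]

omit [SFinite μ₁] [SFinite μ₂] in
lemma inner₁_eq (hreg : M.BetaRegular h a' a'' Q)
    (hγ : ∀ y₁ y₂, M.γ y₁ y₂ ν₀ = γ y₁ y₂) {ω₁ : Θ₁}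
    (hf : (fun y => M.f₁ a' y ω₁) =ᵐ[μ₁] f₁ a') (z : ℝ) :
    Integrable (fun y => h y z * f₁ a' y * γ y z) μ₁ ∧
      M.inner₁ h a' z ω₁ ν₀ = ∫ y, h y z * f₁ a' y * γ y z ∂μ₁ := by
  have he : (fun y => h y z * M.f₁ a' y ω₁ * M.γ y z ν₀) =ᵐ[μ₁]
      fun y => h y z * f₁ a' y * γ y z := by
    filter_upwards [hf] with y hy
    rw [hy, hγ]
  exact ⟨(hreg.integrable₁ z ω₁ ν₀).congr he, integral_congr_ae he⟩

omit [SFinite μ₁] [SFinite μ₂] in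
lemma inner₂_eq (hreg : M.BetaRegular h a' a'' Q)
    (hγ : ∀ y₁ y₂, M.γ y₁ y₂ ν₀ = γ y₁ y₂) {ω₂ : Θ₂}
    (hf : (fun z => M.f₂ a'' z ω₂) =ᵐ[μ₂] f₂ a'') (y : ℝ) :
    Integrable (fun z => h y z * f₂ a'' z * γ y z) μ₂ ∧
      M.inner₂ h a'' y ω₂ ν₀ = ∫ z, h y z * f₂ a'' z * γ y z ∂μ₂ := by
  have he : (fun z => h y z * M.f₂ a'' z ω₂ * M.γ y z ν₀) =ᵐ[μ₂]
      fun z => h y z * f₂ a'' z * γ y z := by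
    filter_upwards [hf] with z hz
    rw [hz, hγ]
  exact ⟨(hreg.integrable₂ y ω₂ ν₀).congr he, integral_congr_ae he⟩

/-- The population version of the doubly robust estimating equation when the first baseline model
is correct. -/
lemma population_beta_of_first (hQ : ObservedLaw μ₁ μ₂ Q f₁ f₂ γ π)
    (hreg : M.BetaRegular h a' a'' Q) (hγ : ∀ y₁ y₂, M.γ y₁ y₂ ν₀ = γ y₁ y₂)
    (hint : Integrable (fun y : ℝ × ℝ => h y.1 y.2 * f₁ a' y.1 * γ y.1 y.2 * f₂ a'' y.2)
      (μ₁.prod μ₂)) {ω₁ : Θ₁} (ω₂ : Θ₂) (hf : (fun y => M.f₁ a' y ω₁) =ᵐ[μ₁] f₁ a') :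
    ∫ z, f₂ a'' z * M.inner₁ h a' z ω₁ ν₀ ∂μ₂ =
      ∫ y : ℝ × ℝ, h y.1 y.2 * f₁ a' y.1 * γ y.1 y.2 * f₂ a'' y.2 ∂(μ₁.prod μ₂) ∧
    ∫ x, M.Udr h a' a'' 0 0 0 x ω₁ ω₂ ν₀ ∂Q = -(π a' *
      ((∫ z, reweighted f₂ M a' a'' ω₂ z ∂μ₂) *
        ∫ y, f₁ a' y * M.inner₂ h a'' y ω₂ ν₀ ∂μ₁)) := by
  have hg := inner₁_eq hreg hγ hf
  constructor
  · rw [integral_prod_symm _ hint]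
    refine integral_congr_ae (ae_of_all _ fun z => ?_)
    simp only [(hg z).2]
    rw [integral_mul_const, mul_comm]
  -- With `y₁` integrated first, the true `f₁` turns `h γ` into `inner₁`, which cancels. The
  -- possibly wrong weight in `z` only multiplies what is left.
  · obtain ⟨j, e⟩ := hQ.integral_Udr_zero hreg hγ ω₁ ω₂ fun y => rfl
    rw [e, integral_prod_symm _ j, ← mul_neg, ← neg_mul, ← integral_neg,
      ← integral_mul_const]
    congr 1
    refine integral_congr_ae (ae_of_all _ fun z => ?_)
    have e2 : ∀ y, f₁ a' y * reweighted f₂ M a' a'' ω₂ z *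
        (h y z * γ y z - M.inner₁ h a' z ω₁ ν₀ - M.inner₂ h a'' y ω₂ ν₀) =
        reweighted f₂ M a' a'' ω₂ z * (h y z * f₁ a' y * γ y z -
          f₁ a' y * M.inner₁ h a' z ω₁ ν₀ - f₁ a' y * M.inner₂ h a'' y ω₂ ν₀) :=
      fun y => by ring
    have i1 := (hQ.integrable_f₁ a').mul_const (M.inner₁ h a' z ω₁ ν₀)
    simp only [e2]
    rw [integral_const_mul, integral_sub_sub (hg z).1 i1 (hQ.integral_U₂ hreg hγ ω₂).1, ← (hg z).2, integral_mul_const, hQ.f₁_integral]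
    ring

/-- The population version of the doubly robust estimating equation when the second baseline model
is correct. -/
lemma population_beta_of_second (hQ : ObservedLaw μ₁ μ₂ Q f₁ f₂ γ π)
    (hreg : M.BetaRegular h a' a'' Q) (hγ : ∀ y₁ y₂, M.γ y₁ y₂ ν₀ = γ y₁ y₂)
    (hint : Integrable (fun y : ℝ × ℝ => h y.1 y.2 * f₁ a' y.1 * γ y.1 y.2 * f₂ a'' y.2)
      (μ₁.prod μ₂)) (ω₁ : Θ₁) {ω₂ : Θ₂} (hf : ∀ a, (fun z => M.f₂ a z ω₂) =ᵐ[μ₂] f₂ a) :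
    ∫ y, f₁ a' y * M.inner₂ h a'' y ω₂ ν₀ ∂μ₁ =
      ∫ y : ℝ × ℝ, h y.1 y.2 * f₁ a' y.1 * γ y.1 y.2 * f₂ a'' y.2 ∂(μ₁.prod μ₂) ∧
    ∫ z, reweighted f₂ M a' a'' ω₂ z ∂μ₂ = 1 ∧
    ∫ x, M.Udr h a' a'' 0 0 0 x ω₁ ω₂ ν₀ ∂Q =
      -(π a' * ∫ z, f₂ a'' z * M.inner₁ h a' z ω₁ ν₀ ∂μ₂) := by
  have hg := inner₂_eq hreg hγ (hf a'')
  -- The weight carries the second baseline from arm `a'` to arm `a''`; this uses correctness in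
  -- both arms.
  have hr : reweighted f₂ M a' a'' ω₂ =ᵐ[μ₂] f₂ a'' := by
    filter_upwards [hf a', hf a''] with z h1 h2
    have := hQ.f₂_pos a' z
    simp only [reweighted, h1, h2]
    field_simp
  refine ⟨?_, ?_, ?_⟩
  · rw [integral_prod _ hint]
    refine integral_congr_ae (ae_of_all _ fun y => ?_)
    simp only [(hg y).2]
    rw [← integral_const_mul]
    refine integral_congr_ae (ae_of_all _ fun z => ?_)
    simp only
    ring
  · rw [integral_congr_ae hr, hQ.f₂_integral]
  · obtain ⟨j, e⟩ := hQ.integral_Udr_zero hreg hγ ω₁ ω₂ fun y => rfl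
    rw [e, integral_prod _ j, ← mul_neg]
    congr 1
    -- Now `y₂` is integrated first, and the `h γ` term cancels `inner₂`.
    have e2 : ∀ y, ∫ z, f₁ a' y * reweighted f₂ M a' a'' ω₂ z *
        (h y z * γ y z - M.inner₁ h a' z ω₁ ν₀ - M.inner₂ h a'' y ω₂ ν₀) ∂μ₂ =
        f₁ a' y * -∫ z, f₂ a'' z * M.inner₁ h a' z ω₁ ν₀ ∂μ₂ := by
      intro y
      have e3 : (fun z => f₁ a' y * reweighted f₂ M a' a'' ω₂ z *
          (h y z * γ y z - M.inner₁ h a' z ω₁ ν₀ - M.inner₂ h a'' y ω₂ ν₀)) =ᵐ[μ₂]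
          fun z => f₁ a' y * (h y z * f₂ a'' z * γ y z -
          f₂ a'' z * M.inner₂ h a'' y ω₂ ν₀ - f₂ a'' z * M.inner₁ h a' z ω₁ ν₀) := by
        filter_upwards [hr] with z hz
        rw [hz]
        ring
      have i1 := (hQ.integrable_f₂ a'').mul_const (M.inner₂ h a'' y ω₂ ν₀)
      rw [integral_congr_ae e3, integral_const_mul,
        integral_sub_sub (hg y).1 i1 (hQ.integral_U₁ hreg hγ ω₁).1, ← (hg y).2, integral_mul_const, hQ.f₂_integral]
      ring
    simp only [e2]
    rw [integral_mul_const, hQ.f₁_integral, one_mul]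

/-- Double robustness: the roots of the population estimating equations give `β_h` if the odds
ratio and one of the two baseline densities are correct. -/
theorem population_beta (hQ : ObservedLaw μ₁ μ₂ Q f₁ f₂ γ π)
    (hreg : M.BetaRegular h a' a'' Q) (hγ : ∀ y₁ y₂, M.γ y₁ y₂ ν₀ = γ y₁ y₂)
    (hint : Integrable (fun y : ℝ × ℝ => h y.1 y.2 * f₁ a' y.1 * γ y.1 y.2 * f₂ a'' y.2)
      (μ₁.prod μ₂)) {ω₁ : Θ₁} {ω₂ : Θ₂} (hf : (∀ a, (fun y => M.f₁ a y ω₁) =ᵐ[μ₁] f₁ a) ∨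
        ∀ a, (fun z => M.f₂ a z ω₂) =ᵐ[μ₂] f₂ a) :
    ∃ u₁ v₁ u₂ v₂ u v : ℝ, ∫ x, M.U₁ h a' a'' 0 x ω₁ ν₀ ∂Q = u₁ ∧
      ∫ x, M.U₁ h a' a'' 1 x ω₁ ν₀ ∂Q = v₁ ∧ ∫ x, M.U₂ h a' a'' 0 x ω₂ ν₀ ∂Q = u₂ ∧
      ∫ x, M.U₂ h a' a'' 1 x ω₂ ν₀ ∂Q = v₂ ∧ ∫ x, M.Udr h a' a'' 0 0 0 x ω₁ ω₂ ν₀ ∂Q = u ∧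
      ∫ x, M.Udr h a' a'' 1 0 0 x ω₁ ω₂ ν₀ ∂Q = v ∧ u₁ - v₁ ≠ 0 ∧ u₂ - v₂ ≠ 0 ∧ u - v ≠ 0 ∧
      u₁ / (u₁ - v₁) + u₂ / (u₂ - v₂) + u / (u - v) =
        ∫ y : ℝ × ℝ, h y.1 y.2 * f₁ a' y.1 * γ y.1 y.2 * f₂ a'' y.2 ∂(μ₁.prod μ₂) := by
  obtain ⟨-, A₁, B₁⟩ := hQ.integral_U₁ hreg hγ ω₁
  obtain ⟨-, A₂, B₂⟩ := hQ.integral_U₂ hreg hγ ω₂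
  obtain ⟨hR, B⟩ := hQ.integral_Udr_sub hreg hγ ω₁ ω₂
  have hπ' := hQ.weight_pos a'
  have hπ'' := hQ.weight_pos a''
  refine ⟨_, _, _, _, _, _, rfl, rfl, rfl, rfl, rfl, rfl, by rw [B₁]; exact hπ''.ne',
    by rw [B₂]; exact hπ'.ne', by rw [B]; exact (mul_pos hπ' hR).ne', ?_⟩
  rw [B₁, B₂, B, A₁, A₂]
  -- The term `u / (u - v)` is minus the root of `U₂` in the first case and minus the root of `U₁`
  -- in the second; the surviving root is `β_h`.
  rcases hf with hf | hf
  · obtain ⟨C, D⟩ := hQ.population_beta_of_first hreg hγ hint ω₂ (hf a')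
    rw [D, ← C]
    field_simp
    ring
  · obtain ⟨C, R, D⟩ := hQ.population_beta_of_second hreg hγ hint ω₁ hf
    rw [D, ← C, R]
    field_simp
    ring

end ObservedLaw


/-! ### From population equations to convergence in probability -/

section Consistency

/-- Convergence in measure to a constant from convergence along all subsequences on which events of
probability tending to one occur. -/
lemma tendstoInMeasure_of_forall_subseq {Ω : Type*} [MeasurableSpace Ω] {P : Measure Ω}
    [IsFiniteMeasure P] {good : ℕ → Ω → Prop}
    (hgood : Tendsto (fun n => P {ω | ¬ good n ω}) atTop (𝓝 0)) {b : ℕ → Ω → ℝ}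
    (hb : ∀ n, AEMeasurable (b n) P) {β : ℝ}
    (h : ∀ᵐ ω ∂P, ∀ ns : ℕ → ℕ, Tendsto ns atTop atTop → (∀ᶠ k in atTop, good (ns k) ω) →
      Tendsto (fun k => b (ns k) ω) atTop (𝓝 β)) :
    TendstoInMeasure P b atTop (fun _ => β) := by
  rw [exists_seq_tendstoInMeasure_atTop_iff fun n => (hb n).aestronglyMeasurable]
  intro ns hns
  -- Along a subsequence the bad events have summable probabilities, so by Borel–Cantelli almost
  -- every `ω` is eventually good.
  obtain ⟨ε, hε, hsum⟩ := ENNReal.exists_pos_sum_of_countable one_ne_zero ℕ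
  obtain ⟨ms, hms, hle⟩ := extraction_forall_of_eventually'
    (P := fun n k => P {ω | ¬ good (ns k) ω} ≤ ε n) fun n =>
      eventually_atTop.1 ((hgood.comp hns.tendsto_atTop).eventually_le_const
        (ENNReal.coe_pos.2 (hε n)))
  refine ⟨ms, hms, ?_⟩
  have hbad := ae_eventually_notMem (μ := P) (s := fun n => {ω | ¬ good (ns (ms n)) ω})
    ((ENNReal.tsum_le_tsum hle).trans_lt (hsum.trans ENNReal.one_lt_top)).ne
  filter_upwards [h, hbad] with ω h1 h2
  exact h1 (fun k => ns (ms k)) (hns.tendsto_atTop.comp hms.tendsto_atTop)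
    (h2.mono fun k hk => not_not.1 hk)

/-- Roots of affine equations converge to the root of the limiting equation. -/
lemma tendsto_root {s t r b : ℕ → ℝ} {u v c : ℝ} (hs : Tendsto s atTop (𝓝 u))
    (ht : Tendsto t atTop (𝓝 v)) (hr : Tendsto r atTop (𝓝 c)) (hne : u - v ≠ 0)
    (h : ∀ᶠ k in atTop, s k + (r k - b k) * (s k - t k) = 0) :
    Tendsto b atTop (𝓝 (c + u / (u - v))) := by
  have hd := hs.sub ht
  refine (hr.add (hs.div hd hne)).congr' ?_
  filter_upwards [h, hd.eventually_ne hne] with k h1 h2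
  simp only [Pi.div_apply]
  field_simp
  linear_combination h1

namespace ParametricModel

variable {μ₁ μ₂ : Measure ℝ} {Θ₁ Θ₂ N : Type*} {M : ParametricModel μ₁ μ₂ Θ₁ Θ₂ N}

/-- The root ranges over all of `ℝ`, which is not compact; affinity reduces the uniform law to the
two values `b = 0, 1`. The form `0 - b` fits `tendsto_root` with `r = 0`. -/
lemma U₁_affine (h : ℝ → ℝ → ℝ) (a' a'' : Fin 2) (b : ℝ) (x : Obs) (ω₁ : Θ₁) (ν : N) :
    M.U₁ h a' a'' b x ω₁ ν = M.U₁ h a' a'' 0 x ω₁ ν +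
      (0 - b) * (M.U₁ h a' a'' 0 x ω₁ ν - M.U₁ h a' a'' 1 x ω₁ ν) := by
  simp only [U₁]
  ring

lemma U₂_affine (h : ℝ → ℝ → ℝ) (a' a'' : Fin 2) (b : ℝ) (x : Obs) (ω₂ : Θ₂) (ν : N) :
    M.U₂ h a' a'' b x ω₂ ν = M.U₂ h a' a'' 0 x ω₂ ν +
      (0 - b) * (M.U₂ h a' a'' 0 x ω₂ ν - M.U₂ h a' a'' 1 x ω₂ ν) := by
  simp only [U₂]
  ring

lemma Udr_affine (h : ℝ → ℝ → ℝ) (a' a'' : Fin 2) (b b₁ b₂ : ℝ) (x : Obs) (ω₁ : Θ₁) (ω₂ : Θ₂)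
    (ν : N) : M.Udr h a' a'' b b₁ b₂ x ω₁ ω₂ ν = M.Udr h a' a'' 0 0 0 x ω₁ ω₂ ν +
      (b₁ + b₂ - b) * (M.Udr h a' a'' 0 0 0 x ω₁ ω₂ ν - M.Udr h a' a'' 1 0 0 x ω₁ ω₂ ν) := by
  simp only [Udr]
  ring

/-- The averages of `F` over a sample converge uniformly in the parameter to its mean. -/
def SampleLaw {T E : Type*} [TopologicalSpace T] [NormedAddCommGroup E] [NormedSpace ℝ E]
    (Q : Measure Obs) (x : ℕ → Obs) (F : Obs → T → E) : Prop :=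
  ∀ (ns : ℕ → ℕ) (t : ℕ → T) (t₀ : T), Tendsto ns atTop atTop → Tendsto t atTop (𝓝 t₀) →
    Tendsto (fun k => (ns k : ℝ)⁻¹ • ∑ i ∈ Finset.range (ns k), F (x i) (t k)) atTop
      (𝓝 (∫ x, F x t₀ ∂Q))

lemma average_affine {n : ℕ} {x : ℕ → Obs} {f g k : Obs → ℝ} {c : ℝ}
    (h : ∀ x, f x = g x + c * (g x - k x)) (h0 : ∑ i ∈ Finset.range n, f (x i) = 0) :
    (n : ℝ)⁻¹ • ∑ i ∈ Finset.range n, g (x i) + c * ((n : ℝ)⁻¹ • ∑ i ∈ Finset.range n, g (x i) -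
      (n : ℝ)⁻¹ • ∑ i ∈ Finset.range n, k (x i)) = 0 := by
  simp only [h, Finset.sum_add_distrib, ← Finset.mul_sum, Finset.sum_sub_distrib] at h0
  simp only [smul_eq_mul]
  linear_combination (n : ℝ)⁻¹ * h0

section

variable [MetricSpace Θ₁] [MetricSpace Θ₂] [MetricSpace N]
  {k : ℕ} {η : Fin 2 → EuclideanSpace ℝ (Fin k)} {Q : Measure Obs} {x : ℕ → Obs}

/-- Limit points of the nuisance estimators solve the population equations. -/
lemma popRoot_of_tendsto
    (hl₁ : SampleLaw Q x fun x (t : Θ₁ × N) => Real.log (M.cond₁ x t.1 t.2))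
    (hl₂ : SampleLaw Q x fun x (t : Θ₂ × N) => Real.log (M.cond₂ x t.1 t.2))
    (hs : SampleLaw Q x fun x (t : Θ₁ × Θ₂ × N) => M.nuScore η x t.1 t.2.1 t.2.2)
    {ns : ℕ → ℕ} (hns : Tendsto ns atTop atTop) {w₁ : ℕ → N → Θ₁} {w₂ : ℕ → N → Θ₂} {ν : ℕ → N}
    (hsol : ∀ᶠ j in atTop, M.NuisanceSolution η x (ns j) (w₁ j) (w₂ j) (ν j))
    {ω₁ : Θ₁} {ω₂ : Θ₂} {ν' : N} (h₁ : Tendsto (fun j => w₁ j (ν j)) atTop (𝓝 ω₁))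
    (h₂ : Tendsto (fun j => w₂ j (ν j)) atTop (𝓝 ω₂)) (hν : Tendsto ν atTop (𝓝 ν')) :
    M.PopMax₁ Q ν' ω₁ ∧ M.PopMax₂ Q ν' ω₂ ∧ ∫ x, M.nuScore η x ω₁ ω₂ ν' ∂Q = 0 := by
  refine ⟨fun ω => ?_, fun ω => ?_, ?_⟩
  -- The competitor `ω` stays fixed while `ν` moves: the likelihood is maximised at every `ν`, in
  -- particular at the estimate.
  · refine le_of_tendsto_of_tendsto (hl₁ ns _ _ hns (tendsto_const_nhds.prodMk_nhds hν))
      (hl₁ ns _ _ hns (h₁.prodMk_nhds hν)) ?_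
    filter_upwards [hsol] with j hj
    exact mul_le_mul_of_nonneg_left (hj.mle₁ (ν j) ω) (by positivity)
  · refine le_of_tendsto_of_tendsto (hl₂ ns _ _ hns (tendsto_const_nhds.prodMk_nhds hν))
      (hl₂ ns _ _ hns (h₂.prodMk_nhds hν)) ?_
    filter_upwards [hsol] with j hj
    exact mul_le_mul_of_nonneg_left (hj.mle₂ (ν j) ω) (by positivity)
  · refine tendsto_nhds_unique (hs ns _ _ hns (h₁.prodMk_nhds (h₂.prodMk_nhds hν))) ?_
    refine tendsto_const_nhds.congr' ?_
    filter_upwards [hsol] with j hj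
    rw [hj.score, smul_zero]

/-- Convergence of the solutions of the estimating equations for `β_h`, given that of the nuisance
estimators. -/
lemma tendsto_of_betaSolution {h : ℝ → ℝ → ℝ} {a' a'' : Fin 2}
    (hU₁ : SampleLaw Q x fun x (t : Θ₁ × N) => M.U₁ h a' a'' 0 x t.1 t.2)
    (hV₁ : SampleLaw Q x fun x (t : Θ₁ × N) => M.U₁ h a' a'' 1 x t.1 t.2)
    (hU₂ : SampleLaw Q x fun x (t : Θ₂ × N) => M.U₂ h a' a'' 0 x t.1 t.2)
    (hV₂ : SampleLaw Q x fun x (t : Θ₂ × N) => M.U₂ h a' a'' 1 x t.1 t.2)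
    (hU : SampleLaw Q x fun x (t : Θ₁ × Θ₂ × N) => M.Udr h a' a'' 0 0 0 x t.1 t.2.1 t.2.2)
    (hV : SampleLaw Q x fun x (t : Θ₁ × Θ₂ × N) => M.Udr h a' a'' 1 0 0 x t.1 t.2.1 t.2.2)
    {ns : ℕ → ℕ} (hns : Tendsto ns atTop atTop) {w₁ : ℕ → Θ₁} {w₂ : ℕ → Θ₂} {ν : ℕ → N}
    {b₁ b₂ b : ℕ → ℝ}
    (hsol : ∀ᶠ j in atTop,
      M.BetaSolution h a' a'' x (ns j) (w₁ j) (w₂ j) (ν j) (b₁ j) (b₂ j) (b j))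
    {ω₁ : Θ₁} {ω₂ : Θ₂} {ν' : N} (h₁ : Tendsto w₁ atTop (𝓝 ω₁)) (h₂ : Tendsto w₂ atTop (𝓝 ω₂))
    (hν : Tendsto ν atTop (𝓝 ν')) {u₁ v₁ u₂ v₂ u v : ℝ}
    (hu₁ : ∫ x, M.U₁ h a' a'' 0 x ω₁ ν' ∂Q = u₁) (hv₁ : ∫ x, M.U₁ h a' a'' 1 x ω₁ ν' ∂Q = v₁)
    (hu₂ : ∫ x, M.U₂ h a' a'' 0 x ω₂ ν' ∂Q = u₂) (hv₂ : ∫ x, M.U₂ h a' a'' 1 x ω₂ ν' ∂Q = v₂)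
    (hu : ∫ x, M.Udr h a' a'' 0 0 0 x ω₁ ω₂ ν' ∂Q = u)
    (hv : ∫ x, M.Udr h a' a'' 1 0 0 x ω₁ ω₂ ν' ∂Q = v)
    (hne₁ : u₁ - v₁ ≠ 0) (hne₂ : u₂ - v₂ ≠ 0) (hne : u - v ≠ 0) :
    Tendsto b atTop (𝓝 (u₁ / (u₁ - v₁) + u₂ / (u₂ - v₂) + u / (u - v))) := by
  subst hu₁ hv₁ hu₂ hv₂ hu hv
  have t₁ := h₁.prodMk_nhds hν
  have t₂ := h₂.prodMk_nhds hν
  have t := h₁.prodMk_nhds t₂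
  have lim₁ := tendsto_root (b := b₁) (hU₁ ns _ _ hns t₁) (hV₁ ns _ _ hns t₁)
    tendsto_const_nhds hne₁ (hsol.mono fun j hj =>
      average_affine (fun x => M.U₁_affine h a' a'' (b₁ j) x (w₁ j) (ν j)) hj.eq₁)
  have lim₂ := tendsto_root (b := b₂) (hU₂ ns _ _ hns t₂) (hV₂ ns _ _ hns t₂)
    tendsto_const_nhds hne₂ (hsol.mono fun j hj =>
      average_affine (fun x => M.U₂_affine h a' a'' (b₂ j) x (w₂ j) (ν j)) hj.eq₂)
  have lim := tendsto_root (b := b) (hU ns _ _ hns t) (hV ns _ _ hns t)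
    (lim₁.add lim₂) hne (hsol.mono fun j hj =>
      average_affine
        (fun x => M.Udr_affine h a' a'' (b j) (b₁ j) (b₂ j) x (w₁ j) (w₂ j) (ν j)) hj.eq_dr)
  simpa only [zero_add] using lim

end

end ParametricModel

/-- Consistency of the doubly robust estimator of `β_h(a', a'')`. -/
theorem beta_consistent {Ω : Type*} [MeasurableSpace Ω] {P : Measure Ω} [IsProbabilityMeasure P]
    {μ₁ μ₂ : Measure ℝ} [SFinite μ₁] [SFinite μ₂] {X : ℕ → Ω → Obs}
    (hindep : Pairwise fun i j => IndepFun (X i) (X j) P)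
    (hident : ∀ i, IdentDistrib (X i) (X 0) P P)
    {f₁ f₂ : Fin 2 → ℝ → ℝ} {γ : ℝ → ℝ → ℝ} {π : Fin 2 → ℝ}
    (hQ : ObservedLaw μ₁ μ₂ (P.map (X 0)) f₁ f₂ γ π)
    {Θ₁ Θ₂ N : Type*} [MetricSpace Θ₁] [CompactSpace Θ₁] [MetricSpace Θ₂] [CompactSpace Θ₂]
    [MetricSpace N] [CompactSpace N] {M : ParametricModel μ₁ μ₂ Θ₁ Θ₂ N}
    {k : ℕ} {η : Fin 2 → EuclideanSpace ℝ (Fin k)} (hreg : M.NuisanceRegular η (P.map (X 0)))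
    (hγ : ∃ ν, ∀ y₁ y₂, M.γ y₁ y₂ ν = γ y₁ y₂)
    (hf : (∃ ω₁, ∀ a y, M.f₁ a y ω₁ = f₁ a y) ∨ ∃ ω₂, ∀ a y, M.f₂ a y ω₂ = f₂ a y)
    {w₁ : ℕ → Ω → N → Θ₁} {w₂ : ℕ → Ω → N → Θ₂} {νhat : ℕ → Ω → N}
    (hnuis : Tendsto (fun n => P {ω | ¬ M.NuisanceSolution η (fun i => X i ω) n
      (w₁ n ω) (w₂ n ω) (νhat n ω)}) atTop (𝓝 0))
    {a' a'' : Fin 2} {h : ℝ → ℝ → ℝ}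
    (hint : Integrable (fun y : ℝ × ℝ => h y.1 y.2 * f₁ a' y.1 * γ y.1 y.2 * f₂ a'' y.2)
      (μ₁.prod μ₂)) (hbreg : M.BetaRegular h a' a'' (P.map (X 0))) {b₁ b₂ b : ℕ → Ω → ℝ}
    (hb : ∀ n, AEMeasurable (b n) P)
    (hsol : Tendsto (fun n => P {ω | ¬ M.BetaSolution h a' a'' (fun i => X i ω) n
      (w₁ n ω (νhat n ω)) (w₂ n ω (νhat n ω)) (νhat n ω) (b₁ n ω) (b₂ n ω) (b n ω)})
      atTop (𝓝 0)) :
    TendstoInMeasure P b atTop (fun _ =>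
      ∫ y : ℝ × ℝ, h y.1 y.2 * f₁ a' y.1 * γ y.1 y.2 * f₂ a'' y.2 ∂(μ₁.prod μ₂)) := by
  obtain ⟨ν₀, hγ⟩ := hγ
  have : Nonempty Ω := nonempty_of_isProbabilityMeasure P
  have : Nonempty Θ₁ := ⟨w₁ 0 (Classical.arbitrary Ω) ν₀⟩
  have : Nonempty Θ₂ := ⟨w₂ 0 (Classical.arbitrary Ω) ν₀⟩
  have : IsProbabilityMeasure (P.map (X 0)) :=
    Measure.isProbabilityMeasure_map (hident 0).aemeasurable_fst
  have hroot : M.PopRoot η (P.map (X 0)) ν₀ := hQ.popRoot hreg hγ hf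
  have hgood : Tendsto (fun n => P {ω | ¬ (M.NuisanceSolution η (fun i => X i ω) n
      (w₁ n ω) (w₂ n ω) (νhat n ω) ∧ M.BetaSolution h a' a'' (fun i => X i ω) n
      (w₁ n ω (νhat n ω)) (w₂ n ω (νhat n ω)) (νhat n ω) (b₁ n ω) (b₂ n ω) (b n ω))})
      atTop (𝓝 0) := by
    refine tendsto_of_tendsto_of_tendsto_of_le_of_le tendsto_const_nhds
      (by simpa using hnuis.add hsol) (fun _ => zero_le) fun n => ?_
    refine (measure_mono fun ω hω => ?_).trans (measure_union_le _ _)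
    exact not_and_or.1 hω
  refine tendstoInMeasure_of_forall_subseq hgood hb ?_
  -- One null set serves all sequences of sample sizes and parameters, so the rest is deterministic.
  filter_upwards [hreg.loglik₁.strong_law hindep hident, hreg.loglik₂.strong_law hindep hident,
    hreg.score.strong_law hindep hident, (hbreg.reg₁ 0).strong_law hindep hident,
    (hbreg.reg₁ 1).strong_law hindep hident, (hbreg.reg₂ 0).strong_law hindep hident,
    (hbreg.reg₂ 1).strong_law hindep hident, (hbreg.reg_dr 0 0 0).strong_law hindep hident,
    (hbreg.reg_dr 1 0 0).strong_law hindep hident] with ω l₁ l₂ l₃ l₄ l₅ l₆ l₇ l₈ l₉ ns hns hω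
  refine tendsto_of_subseq_tendsto fun ms hms => ?_
  obtain ⟨⟨ω₁, ω₂, ν'⟩, φ, hφ, hlim⟩ := CompactSpace.tendsto_subseq fun j =>
    (w₁ (ns (ms j)) ω (νhat (ns (ms j)) ω), w₂ (ns (ms j)) ω (νhat (ns (ms j)) ω),
      νhat (ns (ms j)) ω)
  refine ⟨φ, ?_⟩
  have h₁ := (continuous_fst.tendsto _).comp hlim
  have h₂ := (continuous_snd.fst.tendsto _).comp hlim
  have h₃ := (continuous_snd.snd.tendsto _).comp hlim
  have hmφ := hms.comp hφ.tendsto_atTop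
  have hgd := hmφ.eventually hω
  obtain ⟨m₁, m₂, m₃⟩ := ParametricModel.popRoot_of_tendsto l₁ l₂ l₃ (hns.comp hmφ)
    (hgd.mono fun j hj => hj.1) h₁ h₂ h₃
  obtain rfl : ν' = ν₀ := hreg.unique_root _ _ ⟨ω₁, ω₂, m₁, m₂, m₃⟩ hroot
  -- Which limit point occurs is irrelevant: in the correct model each maximiser gives the true
  -- baseline almost everywhere.
  have hf' : (∀ a, (fun y => M.f₁ a y ω₁) =ᵐ[μ₁] f₁ a) ∨
      ∀ a, (fun y => M.f₂ a y ω₂) =ᵐ[μ₂] f₂ a := by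
    rcases hf with ⟨ω₀, hf⟩ | ⟨ω₀, hf⟩
    · exact Or.inl (hQ.ae_eq_of_popMax₁ hreg hγ hf m₁)
    · exact Or.inr (hQ.ae_eq_of_popMax₂ hreg hγ hf m₂)
  obtain ⟨u₁, v₁, u₂, v₂, u, v, e₁, e₂, e₃, e₄, e₅, e₆, n₁, n₂, n₃, e⟩ :=
    hQ.population_beta hbreg hγ hint hf'
  rw [← e]
  exact ParametricModel.tendsto_of_betaSolution l₄ l₅ l₆ l₇ l₈ l₉ (hns.comp hmφ)
    (hgd.mono fun j hj => hj.2) h₁ h₂ h₃ e₁ e₂ e₃ e₄ e₅ e₆ n₁ n₂ n₃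

/-- Quotients converge in measure to a quotient of constants. -/
lemma tendstoInMeasure_div_const {Ω : Type*} [MeasurableSpace Ω] {P : Measure Ω}
    [IsFiniteMeasure P] {b c : ℕ → Ω → ℝ} (hb : ∀ n, AEMeasurable (b n) P)
    (hc : ∀ n, AEMeasurable (c n) P) {β δ : ℝ} (hδ : δ ≠ 0)
    (h₁ : TendstoInMeasure P b atTop (fun _ => β)) (h₂ : TendstoInMeasure P c atTop (fun _ => δ)) :
    TendstoInMeasure P (fun n ω => b n ω / c n ω) atTop (fun _ => β / δ) := by
  refine (exists_seq_tendstoInMeasure_atTop_iff (f := fun n ω => b n ω / c n ω)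
    fun n => ((hb n).div (hc n)).aestronglyMeasurable).2 fun ns hns => ?_
  obtain ⟨ms, hms, l₁⟩ := (h₁.comp hns.tendsto_atTop).exists_seq_tendsto_ae
  obtain ⟨ks, hks, l₂⟩ := (h₂.comp (hns.comp hms).tendsto_atTop).exists_seq_tendsto_ae
  refine ⟨fun i => ms (ks i), hms.comp hks, ?_⟩
  filter_upwards [l₁, l₂] with ω e₁ e₂
  exact (e₁.comp hks.tendsto_atTop).div e₂ hδ

/-! ### Identification of the potential outcome mean -/

variable {Ω : Type*} [MeasurableSpace Ω] {P : Measure Ω} {μ₁ μ₂ : Measure ℝ}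
  {A : Ω → Fin 2} {Y : Fin 2 → Fin 2 → Ω → ℝ × ℝ} {p : Fin 2 → Fin 2 → ℝ → ℝ → ℝ}

/-- Expectations of functions of the potential outcomes, in terms of the baseline densities and the
odds ratio. -/
lemma ChainGraphModel.exists_expectation_eq [IsProbabilityMeasure P] [SFinite μ₁] [SFinite μ₂]
    (hm : ChainGraphModel μ₁ μ₂ P A Y p) (a' a'' : Fin 2) :
    ∃ C : ℝ, 0 < C ∧ ∀ h : ℝ → ℝ → ℝ, Measurable (Function.uncurry h) →
      (Integrable (fun ω => h (Y a' a'' ω).1 (Y a' a'' ω).2) P ↔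
        Integrable (betaIntegrand μ₁ μ₂ p h a' a'') (μ₁.prod μ₂)) ∧
      ∫ ω, h (Y a' a'' ω).1 (Y a' a'' ω).2 ∂P = C * beta μ₁ μ₂ p h a' a'' := by
  obtain ⟨C, hC, hp⟩ := hm.exists_density_eq a' a''
  refine ⟨C, hC, fun h hh => ?_⟩
  have hd : Measurable fun y : ℝ × ℝ => ENNReal.ofReal (p a' a'' y.1 y.2) :=
    (hm.measurable_p a' a'').ennreal_ofReal
  have he : (fun y : ℝ × ℝ => (ENNReal.ofReal (p a' a'' y.1 y.2)).toReal • h y.1 y.2) =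
      fun y => C * betaIntegrand μ₁ μ₂ p h a' a'' y := by
    funext y
    rw [ENNReal.toReal_ofReal (hm.pos _ _ _ _).le, smul_eq_mul, hp, betaIntegrand]
    ring
  constructor
  · have h1 := integrable_map_measure (μ := P) (f := Y a' a'') (g := fun y => h y.1 y.2)
      hh.aestronglyMeasurable (hm.measurable_Y a' a'').aemeasurable
    rw [hm.law, integrable_withDensity_iff_integrable_smul' hd
      (ae_of_all _ fun _ => ENNReal.ofReal_lt_top), he,
      integrable_const_mul_iff (isUnit_iff_ne_zero.2 hC.ne')] at h1
    exact h1.symm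
  · have h1 := integral_map (μ := P) (φ := Y a' a'') (f := fun y => h y.1 y.2)
      (hm.measurable_Y a' a'').aemeasurable hh.aestronglyMeasurable
    rw [hm.law, integral_withDensity_eq_integral_toReal_smul hd
      (ae_of_all _ fun _ => ENNReal.ofReal_lt_top), he, integral_const_mul] at h1
    exact h1.symm

end Consistency

end DyadDR

end

/-! ### The main theorem -/

theorem mainTheorem5
    {Ω : Type*} [MeasurableSpace Ω] (P : Measure Ω) [IsProbabilityMeasure P]
    (μ₁ μ₂ : Measure ℝ) [SigmaFinite μ₁] [SigmaFinite μ₂]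
    -- the dyads: treatments, potential outcomes and their densities
    (A : ℕ → Ω → Fin 2) (Y : ℕ → Fin 2 → Fin 2 → Ω → ℝ × ℝ)
    (p : Fin 2 → Fin 2 → ℝ → ℝ → ℝ)
    (hmodel : DyadDR.ChainGraphModel μ₁ μ₂ P (A 0) (Y 0) p)
    (hindep : iIndepFun (fun i ω => (A i ω, fun a' a'' => Y i a' a'' ω)) P)
    (hident : ∀ i, IdentDistrib (fun ω => (A i ω, fun a' a'' => Y i a' a'' ω))
      (fun ω => (A 0 ω, fun a' a'' => Y 0 a' a'' ω)) P P)
    -- the parametric models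
    {Θ₁ Θ₂ N : Type*} [MetricSpace Θ₁] [CompactSpace Θ₁] [MetricSpace Θ₂] [CompactSpace Θ₂]
    [MetricSpace N] [CompactSpace N]
    (M : DyadDR.ParametricModel μ₁ μ₂ Θ₁ Θ₂ N)
    {k : ℕ} (η : Fin 2 → EuclideanSpace ℝ (Fin k))
    (hreg : M.NuisanceRegular η (P.map (DyadDR.observe (A 0) (Y 0))))
    -- (i) the odds ratio model is correct
    (hγ : ∃ ν, ∀ y₁ y₂, M.γ y₁ y₂ ν = DyadDR.oddsRatio p y₁ y₂)
    -- (ii) at least one of the two baseline models is correct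
    (hf : (∃ ω₁, ∀ a y, M.f₁ a y ω₁ = DyadDR.baseline₁ μ₁ p a y) ∨
      (∃ ω₂, ∀ a y, M.f₂ a y ω₂ = DyadDR.baseline₂ μ₂ p a y))
    -- the nuisance estimators: the maps `ν ↦ ω̃₁(ν)`, `ν ↦ ω̃₂(ν)`, and `ν̂_dr`
    (w₁ : ℕ → Ω → N → Θ₁) (w₂ : ℕ → Ω → N → Θ₂) (νhat : ℕ → Ω → N)
    (hnuis : Tendsto (fun n => P {ω | ¬ M.NuisanceSolution η
      (fun i => DyadDR.observe (A i) (Y i) ω) n (w₁ n ω) (w₂ n ω) (νhat n ω)}) atTop (𝓝 0))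
    (a' a'' : Fin 2) :
    -- the doubly robust estimator of `β_h(a', a'')` is consistent
    (∀ h : ℝ → ℝ → ℝ, Measurable (Function.uncurry h) →
      Integrable (DyadDR.betaIntegrand μ₁ μ₂ p h a' a'') (μ₁.prod μ₂) →
      M.BetaRegular h a' a'' (P.map (DyadDR.observe (A 0) (Y 0))) →
      ∀ b₁ b₂ b : ℕ → Ω → ℝ, (∀ n, AEMeasurable (b n) P) →
      Tendsto (fun n => P {ω | ¬ M.BetaSolution h a' a''
        (fun i => DyadDR.observe (A i) (Y i) ω) n
        (w₁ n ω (νhat n ω)) (w₂ n ω (νhat n ω)) (νhat n ω)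
        (b₁ n ω) (b₂ n ω) (b n ω)}) atTop (𝓝 0) →
      TendstoInMeasure P b atTop (fun _ => DyadDR.beta μ₁ μ₂ p h a' a'')) ∧
    -- and hence so is the resulting estimator of `ψ(a', a'') = E{Y¹(a', a'')}`
    (Integrable (DyadDR.betaIntegrand μ₁ μ₂ p (fun y₁ _ => y₁) a' a'') (μ₁.prod μ₂) →
      (Integrable (fun ω => (Y 0 a' a'' ω).1) P ∧
        ∫ ω, (Y 0 a' a'' ω).1 ∂P = DyadDR.psi μ₁ μ₂ p a' a'') ∧
      (M.BetaRegular (fun y₁ _ => y₁) a' a'' (P.map (DyadDR.observe (A 0) (Y 0))) →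
        M.BetaRegular (fun _ _ => 1) a' a'' (P.map (DyadDR.observe (A 0) (Y 0))) →
        ∀ b₁ b₂ b c₁ c₂ c : ℕ → Ω → ℝ,
        (∀ n, AEMeasurable (b n) P) → (∀ n, AEMeasurable (c n) P) →
        Tendsto (fun n => P {ω | ¬ M.BetaSolution (fun y₁ _ => y₁) a' a''
          (fun i => DyadDR.observe (A i) (Y i) ω) n
          (w₁ n ω (νhat n ω)) (w₂ n ω (νhat n ω)) (νhat n ω)
          (b₁ n ω) (b₂ n ω) (b n ω)}) atTop (𝓝 0) →
        Tendsto (fun n => P {ω | ¬ M.BetaSolution (fun _ _ => 1) a' a''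
          (fun i => DyadDR.observe (A i) (Y i) ω) n
          (w₁ n ω (νhat n ω)) (w₂ n ω (νhat n ω)) (νhat n ω)
          (c₁ n ω) (c₂ n ω) (c n ω)}) atTop (𝓝 0) →
        TendstoInMeasure P (fun n ω => b n ω / c n ω) atTop
          (fun _ => DyadDR.psi μ₁ μ₂ p a' a''))) := by
  -- The observation is a fixed measurable function of the full record of a dyad, so it inherits
  -- independence and identical distribution.
  have hg : Measurable fun z : Fin 2 × (Fin 2 → Fin 2 → ℝ × ℝ) => ((z.1, z.2 z.1 z.1) : DyadDR.Obs) :=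
    measurable_from_prod_countable_right fun a => measurable_const.prodMk
      ((measurable_pi_apply a).comp (measurable_pi_apply a))
  have hindep' : Pairwise fun i j =>
      IndepFun (DyadDR.observe (A i) (Y i)) (DyadDR.observe (A j) (Y j)) P :=
    fun i j hij => (hindep.comp (fun _ => _) fun _ => hg).indepFun hij
  have hident' : ∀ i, IdentDistrib (DyadDR.observe (A i) (Y i)) (DyadDR.observe (A 0) (Y 0)) P P :=
    fun i => (hident i).comp hg
  obtain ⟨π, hQ⟩ := hmodel.exists_observedLaw
  have hmain : ∀ h : ℝ → ℝ → ℝ,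
      Integrable (DyadDR.betaIntegrand μ₁ μ₂ p h a' a'') (μ₁.prod μ₂) →
      M.BetaRegular h a' a'' (P.map (DyadDR.observe (A 0) (Y 0))) →
      ∀ b₁ b₂ b : ℕ → Ω → ℝ, (∀ n, AEMeasurable (b n) P) →
      Tendsto (fun n => P {ω | ¬ M.BetaSolution h a' a''
        (fun i => DyadDR.observe (A i) (Y i) ω) n
        (w₁ n ω (νhat n ω)) (w₂ n ω (νhat n ω)) (νhat n ω)
        (b₁ n ω) (b₂ n ω) (b n ω)}) atTop (𝓝 0) →
      TendstoInMeasure P b atTop (fun _ => DyadDR.beta μ₁ μ₂ p h a' a'') :=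
    fun h hint hbreg b₁ b₂ b hb hsol => DyadDR.beta_consistent
      (X := fun i => DyadDR.observe (A i) (Y i)) hindep' hident' hQ hreg hγ hf hnuis hint hbreg
      hb hsol
  refine ⟨fun h _ => hmain h, fun hint => ?_⟩
  obtain ⟨C, hC, hexp⟩ := hmodel.exists_expectation_eq a' a''
  obtain ⟨hone, hone'⟩ := hexp (fun _ _ => 1) measurable_const
  obtain ⟨hid, hid'⟩ := hexp (fun y₁ _ => y₁) measurable_fst
  -- Total probability one identifies `β_1` as `1 / C`, so it is nonzero.
  have hδ : C * DyadDR.beta μ₁ μ₂ p (fun _ _ => 1) a' a'' = 1 := by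
    rw [← hone']
    simp
  have hδ0 : DyadDR.beta μ₁ μ₂ p (fun _ _ => 1) a' a'' ≠ 0 := right_ne_zero_of_mul_eq_one hδ
  refine ⟨⟨hid.2 hint, ?_⟩, fun hr₁ hr₂ b₁ b₂ b c₁ c₂ c hb hc hs₁ hs₂ => ?_⟩
  · rw [hid', DyadDR.psi, eq_div_iff hδ0]
    linear_combination DyadDR.beta μ₁ μ₂ p (fun y₁ _ => y₁) a' a'' * hδ
  -- For `h = 1` the integrand of `β_1` is integrable because constants are integrable under `P`.
  · exact DyadDR.tendstoInMeasure_div_const hb hc hδ0 (hmain _ hint hr₁ b₁ b₂ b hb hs₁)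
      (hmain _ (hone.1 (integrable_const 1)) hr₂ c₁ c₂ c hc hs₂)
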